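/- Let $a,b>0$ with $a\neq b$, let $\Theta\in(0,1)$, and let $g:\mathbb R\to\mathbb R$ be the $2\pi$-periodic function with $$g(x)=a \ \text{ for } |x|<\pi\Theta,\qquad g(x)=b\ \text{ for } \pi\Theta<|x|<\pi .$$ Call a real number an odd ratio if it is of the form $\frac{2m+1}{2n+1}$ with integers $m,n\ge 0$. Assume that $\sqrt{\tfrac ba}\,\frac{1-\Theta}{\Theta}$ is an odd ratio. Let $\omega\in\mathbb R$ be such that $4\sqrt a\,\Theta\,\omega$ is an odd ratio (so $\omega>0$), put $T=\frac{2\pi}{\omega}$, let $\mathbb T_T=\mathbb R/T\mathbb Z$, and let $\gamma\in\mathbb R\setminus\{0\}$ (of either sign). Let $\delta_0$ be the delta distribution at $0$, and consider the quasilinear wave equation $$g(x)\,w_{tt}-w_{xx}+\gamma\,\delta_0(x)\,(w_t^3)_t=0 . \qquad (*)$$ A real-valued $w\in H^1(\mathbb R\times\mathbb T_T)$ whose trace $w(0,\cdot)$ at $x=0$ has a weak derivative $\partial_t w(0,\cdot)\in L^3(\mathbb T_T)$ is called a ($T$-periodic) weak solution of $(*)$ if for every $\psi\in C_c^\infty(\mathbb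 R\times\mathbb T_T)$ $$\int_{\mathbb R\times\mathbb T_T}\bigl(-g(x)\,\partial_t w\,\partial_t\psi+\partial_x w\,\partial_x\psi\bigr)\,d(x,t)-\gamma\int_0^T(\partial_t w(0,t))^3\,\partial_t\psi(0,t)\,dt=0 .$$ **Theorem.** There exist infinitely many nontrivial, real-valued, $T$-periodic weak solutions of $(*)$, no two of which are time translates of each other, and each of which is exponentially localized: for each of these solutions $w$ there are constants $C,\rho>0$ with $|w(x,t)|\le C e^{-\rho|x|}$ for all $(x,t)\in\mathbb R^2$. -/

import Mathlib

noncomputable section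

open MeasureTheory Filter Topology Set
open scoped ContDiff

namespace KerrBreather

/-- `x` is a quotient of two odd natural numbers. -/
def IsOddRatio (x : ℝ) : Prop :=
  ∃ m n : ℕ, x = (2 * (m : ℝ) + 1) / (2 * (n : ℝ) + 1)

/-- The `2π`-periodic step potential with value `a` on `|x| < πΘ` and `b` on `πΘ < |x| < π`
(on the null set `|x| = πΘ`, `|x| = π` it takes the value `b`).
Here `toIcoMod _ (-π) x` is the representative of `x` modulo `2π` in `[-π, π)`. -/
def stepPotential (a b Θ : ℝ) (x : ℝ) : ℝ :=
  if |toIcoMod Real.two_pi_pos (-Real.pi) x| < Real.pi * Θ then a else b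

/-!
Functions on `ℝ × 𝕋_T`, with `𝕋_T` the torus of period `T > 0`, are functions of
`(x, t) ∈ ℝ × ℝ` that are `T`-periodic in `t`; integrals over `ℝ × 𝕋_T` are integrals over
the strip `ℝ × (0, T]`.
-/

/-- `T`-periodicity in the second variable. -/
def TimePeriodic (T : ℝ) (w : ℝ × ℝ → ℝ) : Prop :=
  ∀ x t : ℝ, w (x, t + T) = w (x, t)

/-- Lebesgue measure on the strip `ℝ × (0, T]`, that is, on `ℝ × 𝕋_T`. -/
def stripMeasure (T : ℝ) : Measure (ℝ × ℝ) :=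
  (volume : Measure (ℝ × ℝ)).restrict (univ ×ˢ Ioc 0 T)

/-- Lebesgue measure on `(0, T]`, that is, on `𝕋_T`. -/
def circleMeasure (T : ℝ) : Measure ℝ :=
  (volume : Measure ℝ).restrict (Ioc 0 T)

/-- Classical partial derivative in `x`. -/
def dx (ψ : ℝ × ℝ → ℝ) (p : ℝ × ℝ) : ℝ := fderiv ℝ ψ p (1, 0)

/-- Classical partial derivative in `t`. -/
def dt (ψ : ℝ × ℝ → ℝ) (p : ℝ × ℝ) : ℝ := fderiv ℝ ψ p (0, 1)

/-- `ψ ∈ C_c^∞(ℝ × 𝕋_T)`. -/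
structure IsTestFunction (T : ℝ) (ψ : ℝ × ℝ → ℝ) : Prop where
  smooth : ContDiff ℝ ∞ ψ
  periodic : TimePeriodic T ψ
  compact_support : ∃ R : ℝ, ∀ x t : ℝ, R < |x| → ψ (x, t) = 0

/-- `w ∈ H¹(ℝ × 𝕋_T)` with weak partial derivatives `wx = ∂ₓw` and `wt = ∂ₜw`. -/
structure IsSobolevH1 (T : ℝ) (w wx wt : ℝ × ℝ → ℝ) : Prop where
  periodic : TimePeriodic T w
  memLp : MemLp w 2 (stripMeasure T)
  memLp_dx : MemLp wx 2 (stripMeasure T)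
  memLp_dt : MemLp wt 2 (stripMeasure T)
  weak_dx : ∀ ψ, IsTestFunction T ψ →
    ∫ p, w p * dx ψ p ∂(stripMeasure T) = -∫ p, wx p * ψ p ∂(stripMeasure T)
  weak_dt : ∀ ψ, IsTestFunction T ψ →
    ∫ p, w p * dt ψ p ∂(stripMeasure T) = -∫ p, wt p * ψ p ∂(stripMeasure T)

/-- `v = w(0, ·)` in the sense of traces: `v ∈ L²(𝕋_T)`, and the mean over `|x| < ε` of
`‖w(x, ·) - v‖²` in `L²(𝕋_T)` tends to `0` as `ε → 0`. This does not depend on the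
representative of `w`. -/
structure IsTraceAtZero (T : ℝ) (w : ℝ × ℝ → ℝ) (v : ℝ → ℝ) : Prop where
  memLp : MemLp v 2 (circleMeasure T)
  tendsto_mean : Tendsto
    (fun ε : ℝ => (2 * ε)⁻¹ * ∫ p in Ioo (-ε) ε ×ˢ Ioc 0 T, (w p - v p.2) ^ 2)
    (𝓝[>] 0) (𝓝 0)

/-- `z ∈ L³(𝕋_T)` is the weak derivative of `v ∈ L²(𝕋_T)`. -/
structure IsWeakDerivL3 (T : ℝ) (v z : ℝ → ℝ) : Prop where
  memLp : MemLp z 3 (circleMeasure T)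
  weak_deriv : ∀ φ : ℝ → ℝ, ContDiff ℝ ∞ φ → Function.Periodic φ T →
    ∫ t, v t * deriv φ t ∂(circleMeasure T) = -∫ t, z t * φ t ∂(circleMeasure T)

/-- `w` is a `T`-periodic weak solution of `g(x) w_tt - w_xx + γ δ₀(x) (w_t³)_t = 0`:
`w ∈ H¹(ℝ × 𝕋_T)`, the trace `v = w(0, ·)` has a weak derivative `z = ∂ₜw(0, ·) ∈ L³(𝕋_T)`,
and the weak form of the equation holds for all test functions. -/
def IsWeakSolution (g : ℝ → ℝ) (γ T : ℝ) (w : ℝ × ℝ → ℝ) : Prop :=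
  ∃ (wx wt : ℝ × ℝ → ℝ) (v z : ℝ → ℝ),
    IsSobolevH1 T w wx wt ∧ IsTraceAtZero T w v ∧ IsWeakDerivL3 T v z ∧
    ∀ ψ, IsTestFunction T ψ →
      ∫ p, (-(g p.1 * wt p * dt ψ p) + wx p * dx ψ p) ∂(stripMeasure T)
        - γ * ∫ t, z t ^ 3 * dt ψ (0, t) ∂(circleMeasure T) = 0

end KerrBreather

end

noncomputable section

namespace KerrBreather

open MeasureTheory Filter Topology Set
open scoped ContDiff

/-! ### The periodic profile -/

/-! Away from x = 0 the equation is the linear wave equation in a layered medium, and for even w the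
delta term becomes a flux condition at the origin. Introduce a conjugate function Q on x ≥ 0 with
∂ₜQ = ∂ₓP and ∂ₓQ = g ∂ₜP, where P is w on the half line. The condition is then 2 Q(0,t) = γ
(∂ₜP(0,t))³, and no second derivative of w enters (`ConjugatePair.isWeakSolution`).

Let v be the trace at 0, with v(t + 2τ) = -v(t), and let y(x) be the travel time. Inside the layers
P and Q are, up to piecewise constant amplitudes, the sum and the difference of waves in t + y and t
- y built from v and its translate by τ (`superpose`). At x = 0 this gives P = v and Q = ±√a v(t +
τ). When each layer is crossed in an odd multiple of τ, P vanishes identically in t at every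
interface of one kind (entry to or exit from an inner layer), and Q at every interface of the other
kind. An amplitude may jump where its factor vanishes without destroying continuity
(`continuous_amp_mul`). The amplitude of P is made to drop where √g increases and that of Q where √g
decreases, both by the ratio r < 1 of the smaller to the larger of √a, √b. This preserves the
relations between P and Q and gives the exponential decay (`exists_amplitudes`,
`exists_weakSolution_of_profile`).

What remains at the origin is the delay equation (v')³ = κ v(t + τ) with κ = 2√a/|γ|. With u = v(t +
τ), antiperiodicity turns it into the planar system v' = (κu)^(1/3), u' = -(κv)^(1/3), for which
|v|^(4/3) + |u|^(4/3) is conserved. Normalised, its orbit is v = sin|sin|^(1/2), u = cos|cos|^(1/2)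
of an angle, run through at the speed given by `clock`; a shift by a quarter period is a quarter
turn (`exists_quarterPeriod_profile`). Scaling provides every τ > 0, with amplitude increasing in τ.

The odd ratio hypotheses make infinitely many τ admissible, with the parity that matches the sign of
γ and the order of a and b (`exists_quarterPeriods`). Different τ give different maxima of the
trace, and a time translation does not change that maximum. -/

/-- The odd power `x ↦ x |x| ^ (1 / 2)`. -/
def oddPow (x : ℝ) : ℝ := x * √|x|

/-- The odd square root. -/
def oddSqrt (x : ℝ) : ℝ := √x - √(-x)

lemma oddSqrt_of_pos {x : ℝ} (hx : 0 ≤ x) : oddSqrt x = √x := by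
  simp [oddSqrt, Real.sqrt_eq_zero_of_nonpos (neg_nonpos.2 hx)]

lemma oddSqrt_neg (x : ℝ) : oddSqrt (-x) = -oddSqrt x := by simp [oddSqrt]

lemma oddPow_neg (x : ℝ) : oddPow (-x) = -oddPow x := by simp [oddPow]

lemma continuous_oddPow : Continuous oddPow := by unfold oddPow; fun_prop

lemma continuous_oddSqrt : Continuous oddSqrt := by unfold oddSqrt; fun_prop

/-- This is why the cube of the profile's derivative, `oddSqrt` of a cosine, has the same shape as
the profile, `oddPow` of a sine. -/
lemma oddSqrt_pow_three (x : ℝ) : oddSqrt x ^ 3 = oddPow x := by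
  have key : ∀ y : ℝ, 0 ≤ y → oddSqrt y ^ 3 = oddPow y := by
    intro y hy
    rw [oddSqrt_of_pos hy, oddPow, abs_of_nonneg hy, pow_succ, Real.sq_sqrt hy]
  rcases le_total 0 x with h | h
  · exact key x h
  · have := key (-x) (by linarith)
    rw [oddSqrt_neg, oddPow_neg] at this
    linear_combination -this

lemma abs_oddPow_le {x : ℝ} (hx : |x| ≤ 1) : |oddPow x| ≤ 1 := by
  rw [oddPow, abs_mul, abs_of_nonneg (Real.sqrt_nonneg _)]
  exact mul_le_one₀ hx (Real.sqrt_nonneg _) (Real.sqrt_le_one.2 hx)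

lemma hasDerivAt_oddPow {x : ℝ} (hx : x ≠ 0) : HasDerivAt oddPow (3 / 2 * √|x|) x := by
  have h1 : HasDerivAt (fun y : ℝ => |y|) (SignType.sign x : ℝ) x := hasDerivAt_abs hx
  have h2 := (hasDerivAt_id x).mul (h1.sqrt (abs_ne_zero.2 hx))
  refine h2.congr_deriv ?_
  have h3 : √|x| ≠ 0 := (Real.sqrt_pos.2 (abs_pos.2 hx)).ne'
  have h4 : x * (SignType.sign x : ℝ) = √|x| * √|x| := by
    rw [Real.mul_self_sqrt (abs_nonneg x), mul_comm, sign_mul_self]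
  simp only [id]
  field_simp
  linear_combination h4

/-- The speed of the clock that turns the angular variable into time. -/
def tick (θ : ℝ) : ℝ := 3 / 2 * √|Real.sin θ * Real.cos θ|

/-- Time as a function of the angular variable. -/
def clock (θ : ℝ) : ℝ := ∫ s in (0 : ℝ)..θ, tick s

lemma continuous_tick : Continuous tick := by unfold tick; fun_prop

lemma tick_nonneg (θ : ℝ) : 0 ≤ tick θ := by unfold tick; positivity

lemma hasDerivAt_clock (θ : ℝ) : HasDerivAt clock (tick θ) θ :=
  (continuous_tick.integral_hasStrictDerivAt 0 θ).hasDerivAt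

lemma countable_sin_mul_cos_eq_zero : {θ : ℝ | Real.sin θ * Real.cos θ = 0}.Countable := by
  refine (countable_range (fun n : ℤ => (n : ℝ) * Real.pi / 2)).mono ?_
  intro θ hθ
  have h : Real.sin (2 * θ) = 0 := by
    have h0 : Real.sin θ * Real.cos θ = 0 := hθ
    rw [Real.sin_two_mul]; linear_combination 2 * h0
  obtain ⟨n, hn⟩ := Real.sin_eq_zero_iff.1 h
  exact ⟨n, by simp only; linarith⟩

/-- A quarter turn exchanges |sin| and |cos|. Hence all quarter turns take the same time, and a time
shift by `clock (π / 2)` is exactly a quarter turn of the angle. -/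
lemma tick_add_pi_div_two (θ : ℝ) : tick (θ + Real.pi / 2) = tick θ := by
  simp [tick, Real.sin_add_pi_div_two, Real.cos_add_pi_div_two, mul_comm]

lemma clock_sub (x y : ℝ) : clock y - clock x = ∫ s in x..y, tick s :=
  intervalIntegral.integral_interval_sub_left (continuous_tick.intervalIntegrable _ _)
    (continuous_tick.intervalIntegrable _ _)

/-- The speed vanishes only at multiples of π/2, so every interval contains a point where it is
positive. -/
lemma strictMono_clock : StrictMono clock := by
  intro x y hxy
  rw [← sub_pos, clock_sub]
  obtain ⟨c, hc, hc'⟩ := (countable_sin_mul_cos_eq_zero.dense_compl ℝ).exists_between hxy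
  refine intervalIntegral.integral_pos hxy continuous_tick.continuousOn
    (fun s _ => tick_nonneg s) ⟨c, Ioo_subset_Icc_self hc', ?_⟩
  have : Real.sin c * Real.cos c ≠ 0 := hc
  unfold tick; positivity

lemma clock_zero : clock 0 = 0 := by simp [clock]

lemma clock_add_pi_div_two (θ : ℝ) : clock (θ + Real.pi / 2) = clock θ + clock (Real.pi / 2) := by
  have h : Function.Periodic tick (Real.pi / 2) := tick_add_pi_div_two
  have h1 := h.intervalIntegral_add_eq θ 0
  rw [zero_add, ← clock_sub] at h1
  have : clock (Real.pi / 2) = ∫ s in (0 : ℝ)..Real.pi / 2, tick s := rfl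
  linarith

lemma clock_pi_div_two_pos : 0 < clock (Real.pi / 2) := by
  simpa [clock_zero] using strictMono_clock Real.pi_div_two_pos

lemma clock_natMul (n : ℕ) : clock (n * (Real.pi / 2)) = n * clock (Real.pi / 2) := by
  induction n with
  | zero => simp [clock_zero]
  | succ k ih =>
    rw [Nat.cast_succ, add_mul, one_mul, clock_add_pi_div_two, ih]; ring

lemma clock_neg (θ : ℝ) : clock (-θ) = -clock θ := by
  have h : ∀ s, tick (-s) = tick s := fun s => by simp [tick]
  have := intervalIntegral.integral_comp_neg (a := 0) (b := θ) tick
  simp only [h, neg_zero] at this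
  unfold clock
  rw [this, intervalIntegral.integral_symm]

lemma surjective_clock : Function.Surjective clock := by
  intro y
  have hP := clock_pi_div_two_pos
  obtain ⟨n, hn⟩ := exists_nat_ge (|y| / clock (Real.pi / 2))
  rw [div_le_iff₀ hP] at hn
  refine mem_range_of_exists_le_of_exists_ge
    (continuous_iff_continuousAt.2 fun θ => (hasDerivAt_clock θ).continuousAt)
    ⟨-(n * (Real.pi / 2)), ?_⟩ ⟨n * (Real.pi / 2), ?_⟩
  · rw [clock_neg, clock_natMul]; linarith [neg_abs_le y]
  · rw [clock_natMul]; linarith [le_abs_self y]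

/-- The angular variable as a function of time. -/
def phase : ℝ → ℝ := (strictMono_clock.orderIsoOfSurjective clock surjective_clock).symm

lemma clock_phase (t : ℝ) : clock (phase t) = t :=
  (strictMono_clock.orderIsoOfSurjective clock surjective_clock).apply_symm_apply t

lemma continuous_phase : Continuous phase :=
  (strictMono_clock.orderIsoOfSurjective clock surjective_clock).symm.continuous

lemma phase_add (t : ℝ) : phase (t + clock (Real.pi / 2)) = phase t + Real.pi / 2 := by
  apply strictMono_clock.injective
  rw [clock_phase, clock_add_pi_div_two, clock_phase]

lemma phase_zero : phase 0 = 0 :=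
  strictMono_clock.injective (by rw [clock_phase, clock_zero])

lemma injective_phase : Function.Injective phase := fun x y h => by
  rw [← clock_phase x, h, clock_phase]

/-- The factor (3/2)√|sin| from differentiating `oddPow` cancels against 1/`tick`, which leaves
cos/√|cos|. The excluded times are those at which `tick` vanishes and the inverse function theorem
fails. -/
lemma hasDerivAt_oddPow_sin_phase {t : ℝ} (ht : Real.sin (phase t) * Real.cos (phase t) ≠ 0) :
    HasDerivAt (fun s => oddPow (Real.sin (phase s))) (oddSqrt (Real.cos (phase t))) t := by
  have htick : tick (phase t) ≠ 0 := by unfold tick; positivity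
  have h1 : HasDerivAt phase (tick (phase t))⁻¹ t :=
    (hasDerivAt_clock (phase t)).of_local_left_inverse continuous_phase.continuousAt htick
      (Eventually.of_forall clock_phase)
  have h2 := (hasDerivAt_oddPow (left_ne_zero_of_mul ht)).comp t h1.sin
  refine h2.congr_deriv ?_
  have hs : √|Real.sin (phase t)| ≠ 0 :=
    (Real.sqrt_pos.2 (abs_pos.2 (left_ne_zero_of_mul ht))).ne'
  have hc : √|Real.cos (phase t)| ≠ 0 :=
    (Real.sqrt_pos.2 (abs_pos.2 (right_ne_zero_of_mul ht))).ne'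
  have h3 : ∀ x : ℝ, oddSqrt x * √|x| = x := by
    intro x
    rcases le_total 0 x with h | h
    · rw [oddSqrt_of_pos h, abs_of_nonneg h, Real.mul_self_sqrt h]
    · rw [← neg_neg x, oddSqrt_neg, oddSqrt_of_pos (neg_nonneg.2 h), abs_neg,
        abs_of_nonneg (neg_nonneg.2 h), neg_mul, Real.mul_self_sqrt (neg_nonneg.2 h)]
  have h4 := h3 (Real.cos (phase t))
  rw [tick, abs_mul, Real.sqrt_mul (abs_nonneg _)]
  field_simp
  linear_combination -h4

/-- A `C¹` function whose derivative is the cube root of its own translate by a quarter of its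
period. -/
theorem exists_quarterPeriod_profile : ∃ (P : ℝ) (V Z : ℝ → ℝ), 0 < P ∧ Continuous Z ∧
    (∀ t, HasDerivAt V (Z t) t) ∧ (∀ t, Z t ^ 3 = V (t + P)) ∧ (∀ t, V (t + 2 * P) = -V t) ∧
    (∀ t, |V t| ≤ 1) ∧ V P = 1 := by
  have hcV : Continuous fun t => oddPow (Real.sin (phase t)) :=
    continuous_oddPow.comp (Real.continuous_sin.comp continuous_phase)
  have hcZ : Continuous fun t => oddSqrt (Real.cos (phase t)) :=
    continuous_oddSqrt.comp (Real.continuous_cos.comp continuous_phase)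
  refine ⟨clock (Real.pi / 2), fun t => oddPow (Real.sin (phase t)),
    fun t => oddSqrt (Real.cos (phase t)), clock_pi_div_two_pos, hcZ, ?_, ?_, ?_, ?_, ?_⟩
  · intro t
    -- The derivative formula misses countably many times. The fundamental theorem of calculus
    -- tolerates them, and as the integrand is continuous everywhere, the derivative then exists at
    -- every time.
    have key : ∀ x, oddPow (Real.sin (phase x)) =
        oddPow (Real.sin (phase 0)) + ∫ s in (0 : ℝ)..x, oddSqrt (Real.cos (phase s)) := by
      intro x
      have := integral_eq_of_hasDerivAt_off_countable
        (fun t => oddPow (Real.sin (phase t))) (fun t => oddSqrt (Real.cos (phase t)))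
        (a := 0) (b := x) (countable_sin_mul_cos_eq_zero.preimage injective_phase)
        hcV.continuousOn (fun s hs => hasDerivAt_oddPow_sin_phase hs.2)
        (hcZ.intervalIntegrable _ _)
      rw [this]; ring
    rw [funext key]
    exact ((hcZ.integral_hasStrictDerivAt 0 t).hasDerivAt).const_add _
  · intro t
    simp only [oddSqrt_pow_three, phase_add, Real.sin_add_pi_div_two]
  · intro t
    have h : phase (t + 2 * clock (Real.pi / 2)) = phase t + Real.pi := by
      rw [two_mul, ← add_assoc, phase_add, phase_add]; ring
    simp only [h, Real.sin_add_pi, oddPow_neg]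
  · exact fun t => abs_oddPow_le (Real.abs_sin_le_one _)
  · have h : phase (clock (Real.pi / 2)) = Real.pi / 2 := by
      have := phase_add 0
      rwa [zero_add, phase_zero, zero_add] at this
    simp [h, oddPow]

/-- Rescaling of the profile to quarter period `τ`, with an amplitude that increases with `τ`. -/
theorem exists_scaled_profile {κ : ℝ} (hκ : 0 < κ) : ∃ A : ℝ → ℝ, StrictMonoOn A (Ioi 0) ∧
    ∀ τ, 0 < τ → ∃ v z : ℝ → ℝ, Continuous z ∧ (∀ t, HasDerivAt v (z t) t) ∧
      (∀ t, z t ^ 3 = κ * v (t + τ)) ∧ (∀ t, v (t + 2 * τ) = -v t) ∧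
      (∀ t, |v t| ≤ A τ) ∧ v τ = A τ ∧ 0 < A τ := by
  obtain ⟨P, V, Z, hP, hZ, hV, hZV, hanti, hbd, hmax⟩ := exists_quarterPeriod_profile
  -- For v(t) = A V(Pt/τ) the equation (v')³ = κ v(t + τ) reads A³(P/τ)³ = κA, which determines A.
  refine ⟨fun τ => √(κ * (τ / P) ^ 3), ?_, ?_⟩
  · intro x hx y hy hxy
    have hx : 0 < x := hx
    refine Real.sqrt_lt_sqrt (by positivity) ?_
    gcongr
  · intro τ hτ
    have hA : 0 < √(κ * (τ / P) ^ 3) := Real.sqrt_pos.2 (by positivity)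
    have hA2 : √(κ * (τ / P) ^ 3) ^ 2 = κ * (τ / P) ^ 3 := Real.sq_sqrt (by positivity)
    set A := √(κ * (τ / P) ^ 3)
    have hshift : ∀ t, P / τ * (t + τ) = P / τ * t + P := fun t => by field_simp
    refine ⟨fun t => A * V (P / τ * t), fun t => A * (P / τ) * Z (P / τ * t), by fun_prop, ?_, ?_,
      ?_, ?_, ?_, hA⟩
    · intro t
      have h := ((hV (P / τ * t)).comp t ((hasDerivAt_id t).const_mul (P / τ))).const_mul A
      refine h.congr_deriv ?_
      ring
    · intro t
      simp only [hshift, ← hZV, mul_pow]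
      have : A ^ 3 * (P / τ) ^ 3 = κ * A := by
        rw [pow_succ, hA2]; field_simp
      linear_combination Z (P / τ * t) ^ 3 * this
    · intro t
      have : P / τ * (t + 2 * τ) = P / τ * t + 2 * P := by field_simp
      simp only [this, hanti]; ring
    · intro t
      simp only [abs_mul, abs_of_pos hA]
      exact mul_le_of_le_one_right hA.le (hbd _)
    · have : P / τ * τ = P := by field_simp
      simp only [this, hmax, mul_one]; rfl

/-! ### Integration by parts -/

/-- Integration by parts on a half line for a function that is piecewise differentiable. -/
lemma integral_Ioi_mul_deriv_add {Q q φ φ' : ℝ → ℝ} {B : Set ℝ} (hB : B.Countable)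
    (hQ : Continuous Q) (hq : Measurable q) {C : ℝ} (hqC : ∀ x, 0 ≤ x → |q x| ≤ C)
    (hd : ∀ x, 0 < x → x ∉ B → HasDerivAt Q (q x) x)
    (hφ : ∀ x, HasDerivAt φ (φ' x) x) (hφ' : Continuous φ') {R : ℝ}
    (hR : ∀ x, R < x → φ x = 0) :
    IntegrableOn (fun x => Q x * φ' x + q x * φ x) (Ioi 0) ∧
      ∫ x in Ioi 0, (Q x * φ' x + q x * φ x) = -(Q 0 * φ 0) := by
  have hφc : Continuous φ := continuous_iff_continuousAt.2 fun x => (hφ x).continuousAt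
  have hR' : ∀ x, R < x → φ' x = 0 := fun x hx =>
    (hφ x).unique ((hasDerivAt_const x (0 : ℝ)).congr_of_eventuallyEq
      ((eventually_gt_nhds hx).mono fun y hy => hR y hy))
  -- A positive point strictly beyond R, so that the boundary term at S vanishes.
  set S := max R 0 + 1
  have hS0 : 0 < S := by positivity
  have hSR : R < S := (le_max_left R 0).trans_lt (lt_add_one _)
  have hint : IntegrableOn (fun x => Q x * φ' x + q x * φ x) (Ioc 0 S) := by
    refine Integrable.add ?_ ?_
    · exact ((hQ.mul hφ').integrableOn_Icc (a := 0) (b := S)).mono_set Ioc_subset_Icc_self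
    · refine Integrable.bdd_mul (c := C)
        ((hφc.integrableOn_Icc (a := 0) (b := S)).mono_set Ioc_subset_Icc_self)
        hq.aestronglyMeasurable ?_
      exact (ae_restrict_iff' measurableSet_Ioc).2 (Eventually.of_forall fun x hx => hqC x hx.1.le)
  have hzero : ∀ x ∈ Ioi (0 : ℝ) \ Ioc 0 S, Q x * φ' x + q x * φ x = 0 := by
    intro x hx
    have : S < x := by
      by_contra h
      exact hx.2 ⟨hx.1, not_lt.1 h⟩
    rw [hR x (hSR.trans this), hR' x (hSR.trans this)]; ring
  refine ⟨hint.of_forall_sdiff_eq_zero measurableSet_Ioi hzero, ?_⟩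
  rw [setIntegral_eq_of_subset_of_forall_sdiff_eq_zero measurableSet_Ioi Ioc_subset_Ioi_self hzero,
    ← intervalIntegral.integral_of_le hS0.le]
  rw [integral_eq_of_hasDerivAt_off_countable_of_le (fun x => Q x * φ x) _ hS0.le hB
    (hQ.mul hφc).continuousOn ?_
    ((intervalIntegrable_iff_integrableOn_Ioc_of_le hS0.le).2 hint), hR S hSR]
  · ring
  · intro x hx
    exact ((hd x hx.1.1 hx.2).mul (hφ x)).congr_deriv (by ring)

lemma integral_eq_integral_Ioi_add {f : ℝ → ℝ} (h1 : IntegrableOn f (Ioi 0))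
    (h2 : IntegrableOn (fun x => f (-x)) (Ioi 0)) :
    ∫ x, f x = (∫ x in Ioi 0, f x) + ∫ x in Ioi 0, f (-x) := by
  have h3 : IntegrableOn f (Iic 0) := by
    have h4 : IntegrableOn (fun x => f (-x)) (Ici 0) := by
      rw [integrableOn_Ici_iff_integrableOn_Ioi]; exact h2
    simpa using h4.comp_neg
  have h5 := integral_comp_neg_Ioi 0 f
  rw [neg_zero] at h5
  rw [h5, add_comm, intervalIntegral.integral_Iic_add_Ioi h3 h1]

/-- The sign of `x`, with value `1` at `0`. -/
def sgn (x : ℝ) : ℝ := if x < 0 then -1 else 1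

lemma sgn_of_pos {x : ℝ} (hx : 0 < x) : sgn x = 1 := if_neg hx.not_gt

lemma sgn_neg_of_pos {x : ℝ} (hx : 0 < x) : sgn (-x) = -1 := if_pos (neg_lt_zero.2 hx)

lemma measurable_sgn : Measurable sgn :=
  Measurable.ite measurableSet_Iio measurable_const measurable_const

lemma abs_sgn (x : ℝ) : |sgn x| = 1 := by unfold sgn; split_ifs <;> simp

section Line

variable {Q q φ φ' : ℝ → ℝ} {B : Set ℝ} {C R : ℝ}

/-- The two half lines contribute opposite boundary terms at 0: an even extension is continuous
there. -/
lemma integral_even_mul_deriv_add (hB : B.Countable)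
    (hQ : Continuous Q) (hq : Measurable q) (hqC : ∀ x, 0 ≤ x → |q x| ≤ C)
    (hd : ∀ x, 0 < x → x ∉ B → HasDerivAt Q (q x) x)
    (hφ : ∀ x, HasDerivAt φ (φ' x) x) (hφ' : Continuous φ')
    (hR : ∀ x, R < |x| → φ x = 0) :
    ∫ x, (Q |x| * φ' x + sgn x * q |x| * φ x) = 0 := by
  obtain ⟨i1, e1⟩ := integral_Ioi_mul_deriv_add hB hQ hq hqC hd hφ hφ' (R := R)
    fun x hx => hR x (hx.trans_le (le_abs_self x))
  obtain ⟨i2, e2⟩ := integral_Ioi_mul_deriv_add hB hQ hq hqC hd (φ := fun x => φ (-x))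
    (φ' := fun x => -φ' (-x)) (fun x =>
      ((hφ (-x)).comp x (hasDerivAt_neg x)).congr_deriv (by ring)) (by fun_prop) (R := R)
    fun x hx => hR (-x) (hx.trans_le (by simpa using le_abs_self x))
  have c1 : EqOn (fun x => Q x * φ' x + q x * φ x)
      (fun x => Q |x| * φ' x + sgn x * q |x| * φ x) (Ioi 0) := by
    intro x (hx : 0 < x)
    simp only [abs_of_pos hx, sgn_of_pos hx]; ring
  have c2 : EqOn (fun x => -(Q x * -φ' (-x) + q x * φ (-x)))
      (fun x => Q |(-x)| * φ' (-x) + sgn (-x) * q |(-x)| * φ (-x)) (Ioi 0) := by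
    intro x (hx : 0 < x)
    simp only [abs_neg, abs_of_pos hx, sgn_neg_of_pos hx]; ring
  rw [integral_eq_integral_Ioi_add (i1.congr_fun c1 measurableSet_Ioi)
    (i2.neg.congr_fun c2 measurableSet_Ioi), ← setIntegral_congr_fun measurableSet_Ioi c1,
    ← setIntegral_congr_fun measurableSet_Ioi c2, integral_neg, e1, e2]
  simp

/-- The odd extension jumps by 2 Q(0) at the origin. This jump is the source of the delta term in
the weak equation. -/
lemma integral_odd_mul_deriv_add (hB : B.Countable)
    (hQ : Continuous Q) (hq : Measurable q) (hqC : ∀ x, 0 ≤ x → |q x| ≤ C)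
    (hd : ∀ x, 0 < x → x ∉ B → HasDerivAt Q (q x) x)
    (hφ : ∀ x, HasDerivAt φ (φ' x) x) (hφ' : Continuous φ')
    (hR : ∀ x, R < |x| → φ x = 0) :
    ∫ x, (sgn x * Q |x| * φ' x + q |x| * φ x) = -(2 * Q 0 * φ 0) := by
  obtain ⟨i1, e1⟩ := integral_Ioi_mul_deriv_add hB hQ hq hqC hd hφ hφ' (R := R)
    fun x hx => hR x (hx.trans_le (le_abs_self x))
  obtain ⟨i2, e2⟩ := integral_Ioi_mul_deriv_add hB hQ hq hqC hd (φ := fun x => φ (-x))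
    (φ' := fun x => -φ' (-x)) (fun x =>
      ((hφ (-x)).comp x (hasDerivAt_neg x)).congr_deriv (by ring)) (by fun_prop) (R := R)
    fun x hx => hR (-x) (hx.trans_le (by simpa using le_abs_self x))
  have c1 : EqOn (fun x => Q x * φ' x + q x * φ x)
      (fun x => sgn x * Q |x| * φ' x + q |x| * φ x) (Ioi 0) := by
    intro x (hx : 0 < x)
    simp only [abs_of_pos hx, sgn_of_pos hx]; ring
  have c2 : EqOn (fun x => Q x * -φ' (-x) + q x * φ (-x))
      (fun x => sgn (-x) * Q |(-x)| * φ' (-x) + q |(-x)| * φ (-x)) (Ioi 0) := by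
    intro x (hx : 0 < x)
    simp only [abs_neg, abs_of_pos hx, sgn_neg_of_pos hx]; ring
  rw [integral_eq_integral_Ioi_add (i1.congr_fun c1 measurableSet_Ioi)
    (i2.congr_fun c2 measurableSet_Ioi), ← setIntegral_congr_fun measurableSet_Ioi c1,
    ← setIntegral_congr_fun measurableSet_Ioi c2, e1, e2, neg_zero]
  ring

end Line

/-- Integration by parts over a period. -/
lemma integral_circle_mul_deriv {T : ℝ} (hT : 0 < T) {f f' φ φ' : ℝ → ℝ}
    (hf : ∀ t, HasDerivAt f (f' t) t) (hf' : Continuous f')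
    (hφ : ∀ t, HasDerivAt φ (φ' t) t) (hφ' : Continuous φ')
    (hfT : f T = f 0) (hφT : φ T = φ 0) :
    ∫ t, f t * φ' t ∂(circleMeasure T) = -∫ t, f' t * φ t ∂(circleMeasure T) := by
  unfold circleMeasure
  rw [← intervalIntegral.integral_of_le hT.le, ← intervalIntegral.integral_of_le hT.le,
    intervalIntegral.integral_mul_deriv_eq_deriv_mul (fun t _ => hf t) (fun t _ => hφ t)
    (hf'.intervalIntegrable _ _) (hφ'.intervalIntegrable _ _), hfT, hφT]
  ring

/-! ### The strip and its test functions -/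

lemma stripMeasure_eq_prod (T : ℝ) :
    stripMeasure T = (volume : Measure ℝ).prod (circleMeasure T) := by
  unfold stripMeasure circleMeasure
  rw [Measure.volume_eq_prod, ← Measure.prod_restrict, Measure.restrict_univ]

instance (T : ℝ) : IsFiniteMeasure (circleMeasure T) := by
  unfold circleMeasure; infer_instance

/-- A continuous function with support in `|x| ≤ R` is integrable over the strip. -/
lemma integrable_strip {T R : ℝ} {f : ℝ × ℝ → ℝ} (hf : Continuous f)
    (hR : ∀ x t, R < |x| → f (x, t) = 0) : Integrable f (stripMeasure T) := by
  have h1 : IntegrableOn f (Icc (-R) R ×ˢ Icc 0 T) :=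
    hf.continuousOn.integrableOn_compact (isCompact_Icc.prod isCompact_Icc)
  have h2 : IntegrableOn f (Icc (-R) R ×ˢ Ioc 0 T) :=
    h1.mono_set (prod_mono subset_rfl Ioc_subset_Icc_self)
  refine h2.of_forall_sdiff_eq_zero (MeasurableSet.univ.prod measurableSet_Ioc) ?_
  rintro ⟨x, t⟩ h
  refine hR x t ?_
  by_contra hx
  exact h.2 ⟨abs_le.1 (not_lt.1 hx), h.1.2⟩

section TestFunction

variable {T : ℝ} {ψ : ℝ × ℝ → ℝ}

lemma IsTestFunction.hasFDerivAt (h : IsTestFunction T ψ) (p : ℝ × ℝ) :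
    HasFDerivAt ψ (fderiv ℝ ψ p) p :=
  (h.smooth.differentiable (by simp) p).hasFDerivAt

lemma IsTestFunction.hasDerivAt_fst (h : IsTestFunction T ψ) (x t : ℝ) :
    HasDerivAt (fun y => ψ (y, t)) (dx ψ (x, t)) x :=
  (h.hasFDerivAt (x, t)).comp_hasDerivAt x ((hasDerivAt_id x).prodMk (hasDerivAt_const x t))

lemma IsTestFunction.hasDerivAt_snd (h : IsTestFunction T ψ) (x t : ℝ) :
    HasDerivAt (fun s => ψ (x, s)) (dt ψ (x, t)) t :=
  (h.hasFDerivAt (x, t)).comp_hasDerivAt t ((hasDerivAt_const t x).prodMk (hasDerivAt_id t))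

lemma IsTestFunction.fderiv_apply (h : IsTestFunction T ψ) (v : ℝ × ℝ) :
    IsTestFunction T fun p => fderiv ℝ ψ p v where
  smooth := (h.smooth.fderiv_right (m := ∞) (by simp)).clm_apply contDiff_const
  periodic := by
    intro x t
    have h1 : (fun p : ℝ × ℝ => ψ (p + (0, T))) = ψ := by
      funext p
      have := h.periodic p.1 p.2
      simpa [Prod.add_def] using this
    have h2 := fderiv_comp_add_right (𝕜 := ℝ) (f := ψ) (x := (x, t)) (0, T)
    rw [h1] at h2
    simp only [h2, Prod.mk_add_mk, add_zero]
  compact_support := by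
    obtain ⟨R, hR⟩ := h.compact_support
    refine ⟨R, fun x t hx => ?_⟩
    have hev : ψ =ᶠ[𝓝 (x, t)] fun _ => 0 := by
      have : ∀ᶠ p : ℝ × ℝ in 𝓝 (x, t), R < |p.1| :=
        (continuous_fst.abs.continuousAt (x := (x, t))).eventually (eventually_gt_nhds hx)
      exact this.mono fun p hp => hR p.1 p.2 hp
    rw [hev.fderiv_eq]
    simp

lemma IsTestFunction.dx (h : IsTestFunction T ψ) : IsTestFunction T (dx ψ) := h.fderiv_apply _

lemma IsTestFunction.dt (h : IsTestFunction T ψ) : IsTestFunction T (dt ψ) := h.fderiv_apply _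

lemma IsTestFunction.continuous (h : IsTestFunction T ψ) : Continuous ψ := h.smooth.continuous

lemma IsTestFunction.dt_dx (h : IsTestFunction T ψ) (p : ℝ × ℝ) :
    KerrBreather.dt (KerrBreather.dx ψ) p = KerrBreather.dx (KerrBreather.dt ψ) p := by
  have hs : IsSymmSndFDerivAt ℝ ψ p :=
    h.smooth.contDiffAt.isSymmSndFDerivAt (by simp; exact WithTop.coe_le_coe.2 le_top)
  have hd : DifferentiableAt ℝ (fderiv ℝ ψ) p :=
    (h.smooth.fderiv_right (m := ∞) (by simp)).differentiable (by simp) p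
  have key : ∀ u v : ℝ × ℝ, fderiv ℝ (fun q => fderiv ℝ ψ q u) p v = fderiv ℝ (fderiv ℝ ψ) p v u := by
    intro u v
    rw [fderiv_clm_apply hd (differentiableAt_const u)]
    simp
  unfold KerrBreather.dt KerrBreather.dx
  rw [key, key]
  exact hs _ _

lemma IsTestFunction.integrable (h : IsTestFunction T ψ) : Integrable ψ (stripMeasure T) := by
  obtain ⟨R, hR⟩ := h.compact_support
  exact integrable_strip h.continuous hR

lemma IsTestFunction.integrable_mul (h : IsTestFunction T ψ) {f : ℝ × ℝ → ℝ} (hf : Measurable f)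
    {C : ℝ} (hC : ∀ p, |f p| ≤ C) : Integrable (fun p => f p * ψ p) (stripMeasure T) :=
  h.integrable.bdd_mul hf.aestronglyMeasurable (Eventually.of_forall hC)

end TestFunction

/-! ### Weak solutions from conjugate pairs -/

lemma memLp_exp_neg_abs {ρ : ℝ} (hρ : 0 < ρ) :
    MemLp (fun x : ℝ => Real.exp (-ρ * |x|)) 2 volume := by
  rw [memLp_two_iff_integrable_sq (by fun_prop)]
  have h : IntegrableOn (fun x : ℝ => Real.exp (-ρ * |x|) ^ 2) (Ioi 0) := by
    refine (integrableOn_exp_mul_Ioi (a := -(2 * ρ)) (by linarith) 0).congr_fun ?_ measurableSet_Ioi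
    intro x (hx : 0 < x)
    simp only [abs_of_pos hx, ← Real.exp_nat_mul]
    congr 1; push_cast; ring
  have h2 : IntegrableOn (fun x : ℝ => Real.exp (-ρ * |x|) ^ 2) (Iic 0) := by
    have h4 : IntegrableOn (fun x : ℝ => Real.exp (-ρ * |x|) ^ 2) (Ici 0) := by
      rw [integrableOn_Ici_iff_integrableOn_Ioi]; exact h
    simpa using h4.comp_neg
  rw [← integrableOn_univ, ← Iic_union_Ioi (a := (0 : ℝ))]
  exact h2.union h

lemma memLp_strip {T C ρ : ℝ} (hρ : 0 < ρ) {f : ℝ × ℝ → ℝ} (hf : Measurable f)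
    (hb : ∀ x t, |f (x, t)| ≤ C * Real.exp (-ρ * |x|)) : MemLp f 2 (stripMeasure T) := by
  rw [stripMeasure_eq_prod]
  refine (((memLp_exp_neg_abs hρ).comp_fst (circleMeasure T)).const_mul C).of_le
    hf.aestronglyMeasurable (Eventually.of_forall fun p => ?_)
  exact (hb p.1 p.2).trans (le_abs_self _)

/-- Functions `P`, `Q` on the half strip `x ≥ 0` with `∂ₜP = p`, `∂ₜQ = q`, `∂ₓP = q` and
`∂ₓQ = g p`, the latter two off a countable set of `x`, all of them exponentially decaying. -/
structure ConjugatePair (g : ℝ → ℝ) (T C ρ : ℝ) (B : Set ℝ) (P Q p q : ℝ × ℝ → ℝ) : Prop where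
  countable : B.Countable
  rate_pos : 0 < ρ
  continuous_fst : Continuous P
  continuous_snd : Continuous Q
  measurable_fst : Measurable p
  measurable_snd : Measurable q
  periodic_fst : TimePeriodic T P
  periodic_snd : TimePeriodic T Q
  hasDerivAt_time_fst : ∀ x t, HasDerivAt (fun s => P (x, s)) (p (x, t)) t
  hasDerivAt_time_snd : ∀ x t, HasDerivAt (fun s => Q (x, s)) (q (x, t)) t
  continuous_time_fst : ∀ x, Continuous fun t => p (x, t)
  continuous_time_snd : ∀ x, Continuous fun t => q (x, t)
  hasDerivAt_space_fst : ∀ t x, 0 < x → x ∉ B → HasDerivAt (fun y => P (y, t)) (q (x, t)) x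
  hasDerivAt_space_snd : ∀ t x, 0 < x → x ∉ B → HasDerivAt (fun y => Q (y, t)) (g x * p (x, t)) x
  bound_P : ∀ x t, 0 ≤ x → |P (x, t)| ≤ C * Real.exp (-ρ * x)
  bound_Q : ∀ x t, 0 ≤ x → |Q (x, t)| ≤ C * Real.exp (-ρ * x)
  bound_p : ∀ x t, 0 ≤ x → |p (x, t)| ≤ C * Real.exp (-ρ * x)
  bound_q : ∀ x t, 0 ≤ x → |q (x, t)| ≤ C * Real.exp (-ρ * x)

/-- The even reflection in `x` of a function on the half strip. -/
def evenReflection (f : ℝ × ℝ → ℝ) (p : ℝ × ℝ) : ℝ := f (|p.1|, p.2)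

/-- The odd reflection in `x` of a function on the half strip. -/
def oddReflection (f : ℝ × ℝ → ℝ) (p : ℝ × ℝ) : ℝ := sgn p.1 * f (|p.1|, p.2)

lemma measurable_evenReflection {f : ℝ × ℝ → ℝ} (hf : Measurable f) :
    Measurable (evenReflection f) := by
  unfold evenReflection
  exact hf.comp ((continuous_fst.abs.measurable).prodMk measurable_snd)

lemma measurable_oddReflection {f : ℝ × ℝ → ℝ} (hf : Measurable f) :
    Measurable (oddReflection f) :=
  (measurable_sgn.comp measurable_fst).mul (measurable_evenReflection hf)

lemma continuous_evenReflection {f : ℝ × ℝ → ℝ} (hf : Continuous f) :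
    Continuous (evenReflection f) := by
  unfold evenReflection; fun_prop

lemma abs_oddReflection (f : ℝ × ℝ → ℝ) (p : ℝ × ℝ) :
    |oddReflection f p| = |evenReflection f p| := by
  rw [oddReflection, abs_mul, abs_sgn, one_mul]; rfl

lemma abs_evenReflection_le {f : ℝ × ℝ → ℝ} {C ρ : ℝ}
    (h : ∀ x t, 0 ≤ x → |f (x, t)| ≤ C * Real.exp (-ρ * x)) (x t : ℝ) :
    |evenReflection f (x, t)| ≤ C * Real.exp (-ρ * |x|) := h |x| t (abs_nonneg x)

/-- A continuous periodic function has its restriction to `x = 0` as trace. -/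
lemma isTraceAtZero_of_continuous {T : ℝ} (hT : 0 < T) {w : ℝ × ℝ → ℝ} (hw : Continuous w)
    (hv : MemLp (fun t => w (0, t)) 2 (circleMeasure T)) :
    IsTraceAtZero T w fun t => w (0, t) := by
  refine ⟨hv, ?_⟩
  have hf : Continuous fun p : ℝ × ℝ => (w p - w (0, p.2)) ^ 2 := by fun_prop
  rw [Metric.tendsto_nhdsWithin_nhds]
  intro η hη
  have huc := (isCompact_Icc (a := (-1 : ℝ)) (b := 1)).prod (isCompact_Icc (a := (0 : ℝ)) (b := T))
    |>.uniformContinuousOn_of_continuous hf.continuousOn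
  rw [Metric.uniformContinuousOn_iff] at huc
  obtain ⟨δ, hδ, huc⟩ := huc (η / (2 * T)) (by positivity)
  refine ⟨min δ 1, by positivity, fun ε (hε : 0 < ε) hεδ => ?_⟩
  rw [Real.dist_eq, sub_zero, abs_of_pos hε, lt_min_iff] at hεδ
  have hpt : ∀ p ∈ Ioo (-ε) ε ×ˢ Ioc 0 T, ‖(w p - w (0, p.2)) ^ 2‖ ≤ η / (2 * T) := by
    rintro ⟨x, t⟩ ⟨hx, ht⟩
    have h1 := huc (x, t) ⟨⟨by linarith [hx.1], by linarith [hx.2]⟩, ht.1.le, ht.2⟩ (0, t)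
      ⟨⟨by norm_num, by norm_num⟩, ht.1.le, ht.2⟩ (by
        rw [Prod.dist_eq, dist_self, max_eq_left dist_nonneg, Real.dist_eq, sub_zero]
        exact (abs_lt.2 hx).trans hεδ.1)
    simpa [Real.dist_eq] using h1.le
  have hvol : (volume (Ioo (-ε) ε ×ˢ Ioc 0 T)) = ENNReal.ofReal (2 * ε * T) := by
    rw [Measure.volume_eq_prod, Measure.prod_prod, Real.volume_Ioo, Real.volume_Ioc,
      ← ENNReal.ofReal_mul (by linarith)]
    congr 1; ring
  have hle := norm_setIntegral_le_of_norm_le_const (μ := volume)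
    (by rw [hvol]; exact ENNReal.ofReal_lt_top) hpt
  rw [measureReal_def, hvol, ENNReal.toReal_ofReal (by positivity), Real.norm_eq_abs] at hle
  rw [Real.dist_eq, sub_zero, abs_mul, abs_of_pos (inv_pos.2 (by positivity))]
  calc (2 * ε)⁻¹ * |∫ p in Ioo (-ε) ε ×ˢ Ioc 0 T, (w p - w (0, p.2)) ^ 2|
      ≤ (2 * ε)⁻¹ * (η / (2 * T) * (2 * ε * T)) := by gcongr
    _ = η / 2 := by field_simp
    _ < η := by linarith

lemma memLp_circle_of_continuous {T : ℝ} {f : ℝ → ℝ} (hf : Continuous f) (r : ENNReal) :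
    MemLp f r (circleMeasure T) := by
  obtain ⟨C, hC⟩ := (isCompact_Icc (a := (0 : ℝ)) (b := T)).exists_bound_of_continuousOn
    hf.continuousOn
  refine MemLp.of_bound hf.aestronglyMeasurable C ?_
  exact (ae_restrict_iff' measurableSet_Ioc).2
    (Eventually.of_forall fun t ht => hC t (Ioc_subset_Icc_self ht))

namespace ConjugatePair

variable {g : ℝ → ℝ} {T C ρ : ℝ} {B : Set ℝ} {P Q p q : ℝ × ℝ → ℝ}

lemma bound_const (h : ConjugatePair g T C ρ B P Q p q) {f : ℝ × ℝ → ℝ}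
    (hf : ∀ x t, 0 ≤ x → |f (x, t)| ≤ C * Real.exp (-ρ * x)) (x t : ℝ) (hx : 0 ≤ x) :
    |f (x, t)| ≤ C := by
  have hC : 0 ≤ C := by
    simpa using (abs_nonneg _).trans (h.bound_P 0 0 le_rfl)
  refine (hf x t hx).trans (mul_le_of_le_one_right hC (Real.exp_le_one_iff.2 ?_))
  nlinarith [h.rate_pos]

/-- Both weak derivatives come from one-dimensional integration by parts along lines: even
reflection leaves no jump at x = 0, and in time the boundary terms cancel by periodicity. -/
lemma isSobolevH1 (h : ConjugatePair g T C ρ B P Q p q) (hT : 0 < T) :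
    IsSobolevH1 T (evenReflection P) (oddReflection q) (evenReflection p) := by
  have hmP := measurable_evenReflection h.continuous_fst.measurable
  have hmp := measurable_evenReflection h.measurable_fst
  have hmq := measurable_oddReflection h.measurable_snd
  have hbP : ∀ z, |evenReflection P z| ≤ C := fun z => h.bound_const h.bound_P _ _ (abs_nonneg _)
  have hbp : ∀ z, |evenReflection p z| ≤ C := fun z => h.bound_const h.bound_p _ _ (abs_nonneg _)
  have hbq : ∀ z, |oddReflection q z| ≤ C := fun z => by
    rw [abs_oddReflection]; exact h.bound_const h.bound_q _ _ (abs_nonneg _)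
  refine ⟨fun x t => h.periodic_fst _ _, memLp_strip h.rate_pos hmP (abs_evenReflection_le h.bound_P),
    memLp_strip (C := C) h.rate_pos hmq (fun x t => ?_),
    memLp_strip h.rate_pos hmp (abs_evenReflection_le h.bound_p), ?_, ?_⟩
  · rw [abs_oddReflection]; exact abs_evenReflection_le h.bound_q x t
  · intro ψ hψ
    obtain ⟨R, hR⟩ := hψ.compact_support
    have i1 := hψ.dx.integrable_mul hmP hbP
    have i2 := hψ.integrable_mul hmq hbq
    rw [← add_eq_zero_iff_eq_neg, ← integral_add i1 i2]
    have i3 : Integrable (fun z => evenReflection P z * dx ψ z + oddReflection q z * ψ z)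
        (stripMeasure T) := i1.add i2
    rw [stripMeasure_eq_prod] at i3 ⊢
    rw [integral_prod_symm _ i3]
    refine integral_eq_zero_of_ae (Eventually.of_forall fun t => ?_)
    exact integral_even_mul_deriv_add (Q := fun x => P (x, t)) (q := fun x => q (x, t))
      (φ := fun x => ψ (x, t)) (φ' := fun x => dx ψ (x, t)) (R := R) h.countable
      (h.continuous_fst.comp (by fun_prop)) (h.measurable_snd.comp (by fun_prop))
      (fun x hx => h.bound_const h.bound_q x t hx) (h.hasDerivAt_space_fst t)
      (fun x => hψ.hasDerivAt_fst x t) (hψ.dx.continuous.comp (by fun_prop)) (fun x hx => hR x t hx)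
  · intro ψ hψ
    have i1 := hψ.dt.integrable_mul hmP hbP
    have i2 := hψ.integrable_mul hmp hbp
    rw [stripMeasure_eq_prod] at i1 i2 ⊢
    rw [integral_prod _ i1, integral_prod _ i2, ← integral_neg]
    refine integral_congr_ae (Eventually.of_forall fun x => ?_)
    refine integral_circle_mul_deriv hT (f := fun t => P (|x|, t)) (f' := fun t => p (|x|, t))
      (fun t => h.hasDerivAt_time_fst |x| t) (h.continuous_time_fst _) (fun t => hψ.hasDerivAt_snd x t)
      (hψ.dt.continuous.comp (by fun_prop)) ?_ ?_
    · simpa using h.periodic_fst |x| 0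
    · simpa using hψ.periodic x 0

/-- The even reflection of a conjugate pair is a weak solution. -/
theorem isWeakSolution (h : ConjugatePair g T C ρ B P Q p q) (hT : 0 < T) {G γ : ℝ}
    (hg : Measurable g) (hgG : ∀ x, |g x| ≤ G) (hg_even : ∀ x, g |x| = g x)
    (hjump : ∀ t, 2 * Q (0, t) = γ * p (0, t) ^ 3) :
    IsWeakSolution g γ T (evenReflection P) := by
  have hG : 0 ≤ G := (abs_nonneg _).trans (hgG 0)
  have hmp := measurable_evenReflection h.measurable_fst
  have hmq := measurable_oddReflection h.measurable_snd
  have hmQ := measurable_oddReflection h.continuous_snd.measurable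
  have hbp : ∀ z, |evenReflection p z| ≤ C := fun z => h.bound_const h.bound_p _ _ (abs_nonneg _)
  have hbq : ∀ z, |oddReflection q z| ≤ C := fun z => by
    rw [abs_oddReflection]; exact h.bound_const h.bound_q _ _ (abs_nonneg _)
  have hbQ : ∀ z, |oddReflection Q z| ≤ C := fun z => by
    rw [abs_oddReflection]; exact h.bound_const h.bound_Q _ _ (abs_nonneg _)
  have hmgp : Measurable fun z : ℝ × ℝ => g z.1 * evenReflection p z :=
    (hg.comp _root_.measurable_fst).mul hmp
  have hbgp : ∀ z : ℝ × ℝ, |g z.1 * evenReflection p z| ≤ G * C := fun z => by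
    rw [abs_mul]; exact mul_le_mul (hgG _) (hbp z) (abs_nonneg _) hG
  have hPc : Continuous (evenReflection P) := continuous_evenReflection h.continuous_fst
  have htr : (fun t => evenReflection P (0, t)) = fun t => P (0, t) := by
    funext t; simp [evenReflection]
  have hPt : Continuous fun t => P (0, t) := h.continuous_fst.comp (by fun_prop)
  refine ⟨oddReflection q, evenReflection p, fun t => P (0, t), fun t => p (0, t),
    h.isSobolevH1 hT, ?_, ⟨memLp_circle_of_continuous (h.continuous_time_fst 0) 3, ?_⟩, ?_⟩
  · rw [← htr]
    exact isTraceAtZero_of_continuous hT hPc (htr ▸ memLp_circle_of_continuous hPt 2)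
  · intro φ hφ hφT
    refine integral_circle_mul_deriv hT (fun t => h.hasDerivAt_time_fst 0 t)
      (h.continuous_time_fst _) (fun t => (hφ.differentiable (by simp) t).hasDerivAt)
      (hφ.continuous_deriv (by simp)) ?_ ?_
    · simpa using h.periodic_fst 0 0
    · simpa using hφT 0
  · intro ψ hψ
    obtain ⟨R, hR⟩ := hψ.dt.compact_support
    have i1 := hψ.dt.integrable_mul hmgp hbgp
    have i2 := hψ.dx.integrable_mul hmq hbq
    have i1' : Integrable (fun z : ℝ × ℝ => -(g z.1 * evenReflection p z * dt ψ z))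
        (stripMeasure T) := i1.neg
    have i3 := hψ.dx.dt.integrable_mul hmQ hbQ
    -- Since q = ∂ₜQ, the t-derivative is moved onto the test function. Only first derivatives of P
    -- and Q are then needed.
    have e1 : ∫ z, oddReflection q z * dx ψ z ∂(stripMeasure T)
        = -∫ z, oddReflection Q z * dt (dx ψ) z ∂(stripMeasure T) := by
      rw [stripMeasure_eq_prod] at i2 i3 ⊢
      rw [integral_prod _ i2, integral_prod _ i3, ← integral_neg]
      refine integral_congr_ae (Eventually.of_forall fun x => ?_)
      have := integral_circle_mul_deriv hT (f := fun t => sgn x * Q (|x|, t))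
        (f' := fun t => sgn x * q (|x|, t)) (φ := fun t => dx ψ (x, t))
        (φ' := fun t => dt (dx ψ) (x, t))
        (fun t => (h.hasDerivAt_time_snd |x| t).const_mul (sgn x))
        ((h.continuous_time_snd _).const_smul (sgn x)) (fun t => hψ.dx.hasDerivAt_snd x t)
        (hψ.dx.dt.continuous.comp (by fun_prop))
        (by simpa using congrArg (sgn x * ·) (h.periodic_snd |x| 0))
        (by simpa using hψ.dx.periodic x 0)
      simp only [oddReflection]
      rw [this, neg_neg]
    -- Integration by parts in x against ∂ₜψ, with ∂ₓQ = g p: all that survives is the jump 2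
    -- Q(0,t), which `hjump` identifies with γ p(0,t)³.
    have e2 : ∫ z, (oddReflection Q z * dt (dx ψ) z + g z.1 * evenReflection p z * dt ψ z)
        ∂(stripMeasure T) = -∫ t, γ * (p (0, t) ^ 3 * dt ψ (0, t)) ∂(circleMeasure T) := by
      have i4 : Integrable (fun z => oddReflection Q z * dt (dx ψ) z
          + g z.1 * evenReflection p z * dt ψ z) (stripMeasure T) := i3.add i1
      rw [stripMeasure_eq_prod] at i4 ⊢
      rw [integral_prod_symm _ i4, ← integral_neg]
      refine integral_congr_ae (Eventually.of_forall fun t => ?_)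
      have := integral_odd_mul_deriv_add (Q := fun x => Q (x, t)) (q := fun x => g x * p (x, t))
        (φ := fun x => dt ψ (x, t)) (φ' := fun x => dx (dt ψ) (x, t)) (R := R) (C := G * C)
        h.countable (h.continuous_snd.comp (by fun_prop))
        (hg.mul (h.measurable_fst.comp (by fun_prop)))
        (fun x hx => by
          rw [abs_mul]
          exact mul_le_mul (hgG _) (h.bound_const h.bound_p x t hx) (abs_nonneg _) hG)
        (h.hasDerivAt_space_snd t)
        (fun x => hψ.dt.hasDerivAt_fst x t) (hψ.dt.dx.continuous.comp (by fun_prop))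
        (fun x hx => hR x t hx)
      simp only [hg_even, hjump] at this
      simp only [oddReflection, evenReflection, hψ.dt_dx]
      rw [this]; ring
    have e3 : ∫ z, (-(g z.1 * evenReflection p z * dt ψ z) + oddReflection q z * dx ψ z)
        ∂(stripMeasure T) = γ * ∫ t, p (0, t) ^ 3 * dt ψ (0, t) ∂(circleMeasure T) := by
      rw [integral_add i1' i2, e1, integral_neg]
      rw [integral_add i3 i1, integral_const_mul] at e2
      linear_combination -e2
    rw [e3, sub_self]

end ConjugatePair

/-! ### The amplitude and the travel time in the layered medium -/

/-- A geometrically decaying step function that jumps at the points `2πn - e`. -/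
def amp (r e x : ℝ) : ℝ := r ^ ⌊(x + e) / (2 * Real.pi)⌋

lemma amp_pos {r : ℝ} (hr : 0 < r) (e x : ℝ) : 0 < amp r e x := zpow_pos hr _

lemma measurable_amp (r e : ℝ) : Measurable (amp r e) := by
  have h : Measurable fun n : ℤ => r ^ n := measurable_of_countable _
  exact h.comp (Int.measurable_floor.comp (by fun_prop))

/-- The floor differs from x/(2π) by less than 2: one unit for rounding and, crudely, one for the
shift e. This accounts for the factor r^(-2). -/
lemma amp_le {r e : ℝ} (hr : 0 < r) (hr1 : r < 1) (he : |e| < Real.pi) (x : ℝ) :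
    amp r e x ≤ r ^ (-2 : ℤ) * Real.exp (-(-Real.log r / (2 * Real.pi)) * x) := by
  have hπ := Real.pi_pos
  have h1 : Real.exp (-(-Real.log r / (2 * Real.pi)) * x) = r ^ (x / (2 * Real.pi)) := by
    rw [Real.rpow_def_of_pos hr]; congr 1; ring
  rw [h1, amp, ← Real.rpow_intCast, ← Real.rpow_intCast, ← Real.rpow_add hr]
  refine Real.rpow_le_rpow_of_exponent_ge hr hr1.le ?_
  have h2 := Int.lt_floor_add_one ((x + e) / (2 * Real.pi))
  have h3 : -1 ≤ e / (2 * Real.pi) := by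
    rw [le_div_iff₀ (by positivity)]; linarith [(abs_lt.1 he).1]
  push_cast
  have h4 : (x + e) / (2 * Real.pi) = x / (2 * Real.pi) + e / (2 * Real.pi) := add_div _ _ _
  linarith

/-- The jumps of `amp` sit where F vanishes for all times, and `amp` is locally bounded. -/
lemma continuous_amp_mul {r e : ℝ} (hr : 0 < r) (hr1 : r < 1) {F : ℝ × ℝ → ℝ}
    (hF : Continuous F) (hz : ∀ (n : ℤ) t, F (2 * Real.pi * n - e, t) = 0) :
    Continuous fun p : ℝ × ℝ => amp r e p.1 * F p := by
  have hπ := Real.pi_pos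
  rw [continuous_iff_continuousAt]
  rintro ⟨x, t⟩
  have hs : Continuous fun p : ℝ × ℝ => (p.1 + e) / (2 * Real.pi) := by fun_prop
  rcases (Int.floor_le ((x + e) / (2 * Real.pi))).eq_or_lt with h | h
  · have hx : x = 2 * Real.pi * (⌊(x + e) / (2 * Real.pi)⌋ : ℤ) - e := by
      rw [h]; field_simp; ring
    have hF0 : F (x, t) = 0 := by rw [hx]; exact hz _ t
    set n := ⌊(x + e) / (2 * Real.pi)⌋
    rw [ContinuousAt, hF0, mul_zero]
    -- Just left of the jump the floor is n - 1, and since r < 1 this gives the larger value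
    -- r^(n-1), which bounds `amp` on both sides.
    have hev : ∀ᶠ p : ℝ × ℝ in 𝓝 (x, t), ((n - 1 : ℤ) : ℝ) < (p.1 + e) / (2 * Real.pi) := by
      refine hs.continuousAt.eventually (eventually_gt_nhds ?_)
      simp only [← h]; push_cast; linarith
    refine squeeze_zero_norm' (a := fun p => r ^ (n - 1) * |F p|) ?_ ?_
    · filter_upwards [hev] with p hp
      rw [norm_mul, Real.norm_eq_abs, Real.norm_eq_abs, abs_of_pos (amp_pos hr _ _)]
      gcongr
      exact zpow_le_zpow_right_of_le_one₀ hr hr1.le (Int.le_floor.2 hp.le)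
    · have : Continuous fun p => r ^ (n - 1) * |F p| := by fun_prop
      simpa [hF0] using this.tendsto (x, t)
  · have h2 := Int.lt_floor_add_one ((x + e) / (2 * Real.pi))
    have hev : ∀ᶠ p : ℝ × ℝ in 𝓝 (x, t), amp r e x * F p = amp r e p.1 * F p := by
      filter_upwards [hs.continuousAt.eventually (eventually_gt_nhds h),
        hs.continuousAt.eventually (eventually_lt_nhds h2)] with p h1 h2
      rw [amp, amp, Int.floor_eq_iff.2 ⟨h1.le, h2⟩]
    exact ContinuousAt.congr (by fun_prop) hev

/-- The discontinuities of the step potential. -/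
def interfaces (Θ : ℝ) : Set ℝ :=
  range (fun n : ℤ => 2 * Real.pi * n - Real.pi * Θ) ∪
    range fun n : ℤ => 2 * Real.pi * n + Real.pi * Θ

lemma countable_interfaces (Θ : ℝ) : (interfaces Θ).Countable :=
  (countable_range _).union (countable_range _)

/-! ### The layers of the step potential and the travel time through them -/

section Potential

variable {a b Θ : ℝ}

lemma toIcoMod_of_mem {x : ℝ} (n : ℤ) (h1 : -Real.pi ≤ x - 2 * Real.pi * n)
    (h2 : x - 2 * Real.pi * n < Real.pi) :
    toIcoMod Real.two_pi_pos (-Real.pi) x = x - 2 * Real.pi * n := by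
  rw [toIcoMod_eq_iff]
  refine ⟨⟨h1, by linarith⟩, n, ?_⟩
  rw [zsmul_eq_mul]; ring

lemma stepPotential_inner (hΘ : Θ ∈ Ioo (0 : ℝ) 1) {x : ℝ} (n : ℤ)
    (h : |x - 2 * Real.pi * n| < Real.pi * Θ) : stepPotential a b Θ x = a := by
  have hπ := Real.pi_pos
  have h3 : Real.pi * Θ < Real.pi := by nlinarith [hΘ.2]
  have h' := abs_lt.1 h
  rw [stepPotential, toIcoMod_of_mem n (by linarith) (by linarith), if_pos h]

lemma stepPotential_outer (hΘ : Θ ∈ Ioo (0 : ℝ) 1) {x : ℝ} (n : ℤ)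
    (h1 : 2 * Real.pi * n + Real.pi * Θ ≤ x)
    (h2 : x ≤ 2 * Real.pi * (n + 1) - Real.pi * Θ) : stepPotential a b Θ x = b := by
  have hπ := Real.pi_pos
  have h3 : 0 < Real.pi * Θ := mul_pos hπ hΘ.1
  rcases lt_or_ge (x - 2 * Real.pi * n) Real.pi with h | h
  · rw [stepPotential, toIcoMod_of_mem n (by linarith) h, if_neg]
    rw [not_lt]; exact (by linarith : _ ≤ x - 2 * Real.pi * n).trans (le_abs_self _)
  · rw [stepPotential, toIcoMod_of_mem (n + 1) (by push_cast; linarith)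
      (by push_cast; linarith), if_neg]
    rw [not_lt]; push_cast
    exact (by linarith : _ ≤ -(x - 2 * Real.pi * (n + 1))).trans (neg_le_abs _)

lemma exists_cell (Θ : ℝ) (x : ℝ) :
    ∃ n : ℤ, 2 * Real.pi * n - Real.pi * Θ ≤ x ∧ x < 2 * Real.pi * (n + 1) - Real.pi * Θ := by
  have hπ := Real.two_pi_pos
  refine ⟨⌊(x + Real.pi * Θ) / (2 * Real.pi)⌋, ?_, ?_⟩
  · have := Int.floor_le ((x + Real.pi * Θ) / (2 * Real.pi))
    rw [le_div_iff₀ hπ] at this; linarith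
  · have := Int.lt_floor_add_one ((x + Real.pi * Θ) / (2 * Real.pi))
    rw [div_lt_iff₀ hπ] at this; linarith

lemma stepPotential_eq_or (a b Θ x : ℝ) :
    stepPotential a b Θ x = a ∨ stepPotential a b Θ x = b := by
  unfold stepPotential; split_ifs <;> simp

lemma stepPotential_abs (hΘ : Θ ∈ Ioo (0 : ℝ) 1) (x : ℝ) :
    stepPotential a b Θ |x| = stepPotential a b Θ x := by
  rcases le_total 0 x with hx | hx
  · rw [abs_of_nonneg hx]
  rw [abs_of_nonpos hx]
  obtain ⟨n, h1, h2⟩ := exists_cell Θ x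
  rcases lt_or_ge x (2 * Real.pi * n + Real.pi * Θ) with h | h
  · rcases h1.eq_or_lt with h1 | h1
    -- The left end of a cell is an interface, where the potential takes the value b. It is
    -- therefore treated as the right end of the preceding outer layer.
    · rw [stepPotential_outer hΘ (x := x) (n - 1), stepPotential_outer hΘ (x := -x) (-n)] <;>
      push_cast <;> nlinarith [Real.pi_pos, mul_pos Real.pi_pos hΘ.1,
        mul_pos Real.pi_pos (sub_pos.2 hΘ.2)]
    · rw [stepPotential_inner (x := x) hΘ n (abs_lt.2 ⟨by linarith, by linarith⟩),
        stepPotential_inner hΘ (-n)]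
      push_cast
      exact abs_lt.2 ⟨by linarith, by linarith⟩
  · rw [stepPotential_outer hΘ n h h2.le, stepPotential_outer hΘ (-n - 1)] <;> push_cast <;>
      linarith

lemma measurable_stepPotential (a b Θ : ℝ) : Measurable (stepPotential a b Θ) := by
  have h : Measurable (toIcoMod Real.two_pi_pos (-Real.pi)) := by
    have : toIcoMod Real.two_pi_pos (-Real.pi) = fun x : ℝ =>
        -Real.pi + Int.fract ((x - -Real.pi) / (2 * Real.pi)) * (2 * Real.pi) := by
      funext x; exact toIcoMod_eq_add_fract_mul _ _ _
    rw [this]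
    exact ((measurable_fract.comp (by fun_prop : Measurable fun x : ℝ =>
      (x - -Real.pi) / (2 * Real.pi))).mul_const _).const_add _
  exact Measurable.ite (measurableSet_lt h.abs measurable_const) measurable_const measurable_const

lemma periodic_stepPotential (a b Θ : ℝ) : Function.Periodic (stepPotential a b Θ) (2 * Real.pi) := by
  intro x
  simp only [stepPotential, toIcoMod_add_right]

/-- Off the interfaces, `x` lies in the interior of a layer. -/
lemma mem_layer_of_notMem_interfaces {x : ℝ} (hx : x ∉ interfaces Θ) :
    ∃ n : ℤ, |x - 2 * Real.pi * n| < Real.pi * Θ ∨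
      (2 * Real.pi * n + Real.pi * Θ < x ∧ x < 2 * Real.pi * (n + 1) - Real.pi * Θ) := by
  obtain ⟨n, h1, h2⟩ := exists_cell Θ x
  have h3 : 2 * Real.pi * n - Real.pi * Θ ≠ x := fun h => hx (Or.inl ⟨n, h⟩)
  have h4 : 2 * Real.pi * n + Real.pi * Θ ≠ x := fun h => hx (Or.inr ⟨n, h⟩)
  refine ⟨n, ?_⟩
  rcases lt_or_gt_of_ne h4 with h | h
  · exact Or.inr ⟨h, h2⟩
  · exact Or.inl (abs_lt.2 ⟨by linarith [lt_of_le_of_ne h1 h3], by linarith⟩)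

lemma amp_eq {r e x : ℝ} {n : ℤ} (h1 : 2 * Real.pi * n ≤ x + e)
    (h2 : x + e < 2 * Real.pi * (n + 1)) : amp r e x = r ^ n := by
  have hπ := Real.two_pi_pos
  have h : ⌊(x + e) / (2 * Real.pi)⌋ = n := by
    rw [Int.floor_eq_iff, le_div_iff₀ hπ, div_lt_iff₀ hπ]
    constructor <;> linarith
  rw [amp, h]

/-- The values in the interior of the inner layers. -/
lemma layer_inner (hΘ : Θ ∈ Ioo (0 : ℝ) 1) (r : ℝ) {x : ℝ} {n : ℤ}
    (h : |x - 2 * Real.pi * n| < Real.pi * Θ) :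
    stepPotential a b Θ x = a ∧ amp r (Real.pi * Θ) x = r ^ n ∧
      amp r (-(Real.pi * Θ)) x = r ^ (n - 1) := by
  have hπ := Real.pi_pos
  have h3 : Real.pi * Θ < Real.pi := by nlinarith [hΘ.2]
  have h' := abs_lt.1 h
  refine ⟨stepPotential_inner hΘ n h, amp_eq ?_ ?_, amp_eq ?_ ?_⟩ <;> push_cast <;> linarith

/-- The values in the interior of the outer layers. -/
lemma layer_outer (hΘ : Θ ∈ Ioo (0 : ℝ) 1) (r : ℝ) {x : ℝ} {n : ℤ}
    (h1 : 2 * Real.pi * n + Real.pi * Θ < x)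
    (h2 : x < 2 * Real.pi * (n + 1) - Real.pi * Θ) :
    stepPotential a b Θ x = b ∧ amp r (Real.pi * Θ) x = r ^ n ∧
      amp r (-(Real.pi * Θ)) x = r ^ n := by
  have hπ := Real.pi_pos
  have h3 : 0 < Real.pi * Θ := mul_pos hπ hΘ.1
  refine ⟨stepPotential_outer hΘ n h1.le h2.le, amp_eq ?_ ?_, amp_eq ?_ ?_⟩ <;> linarith

/-- The potential and the amplitudes are locally constant off the interfaces. -/
lemma eventually_eq_of_notMem_interfaces (hΘ : Θ ∈ Ioo (0 : ℝ) 1) (r : ℝ) {x : ℝ}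
    (hx : x ∉ interfaces Θ) : ∀ᶠ y in 𝓝 x,
      stepPotential a b Θ y = stepPotential a b Θ x ∧
      amp r (Real.pi * Θ) y = amp r (Real.pi * Θ) x ∧
      amp r (-(Real.pi * Θ)) y = amp r (-(Real.pi * Θ)) x := by
  obtain ⟨n, h | ⟨h1, h2⟩⟩ := mem_layer_of_notMem_interfaces hx
  · have hc : ContinuousAt (fun y : ℝ => |y - 2 * Real.pi * n|) x := by fun_prop
    obtain ⟨e1, e2, e3⟩ := layer_inner (a := a) (b := b) hΘ r h
    filter_upwards [hc.eventually (eventually_lt_nhds h)] with y hy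
    rw [e1, e2, e3]
    exact layer_inner hΘ r hy
  · obtain ⟨e1, e2, e3⟩ := layer_outer (a := a) (b := b) hΘ r h1 h2
    filter_upwards [eventually_gt_nhds h1, eventually_lt_nhds h2] with y hy1 hy2
    rw [e1, e2, e3]
    exact layer_outer hΘ r hy1 hy2

/-- The travel time of a wave from `0` to `x`. -/
def travel (a b Θ x : ℝ) : ℝ := ∫ s in (0 : ℝ)..x, √(stepPotential a b Θ s)

lemma intervalIntegrable_sqrt_stepPotential (a b Θ x y : ℝ) :
    IntervalIntegrable (fun s => √(stepPotential a b Θ s)) volume x y := by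
  refine (intervalIntegrable_const (c := √a + √b)).mono_fun
    (measurable_stepPotential a b Θ).sqrt.aestronglyMeasurable (Eventually.of_forall fun s => ?_)
  simp only [Real.norm_of_nonneg (Real.sqrt_nonneg _),
    Real.norm_of_nonneg (add_nonneg (Real.sqrt_nonneg a) (Real.sqrt_nonneg b))]
  rcases stepPotential_eq_or a b Θ s with h | h <;> rw [h] <;> simp

lemma continuous_travel (a b Θ : ℝ) : Continuous (travel a b Θ) :=
  intervalIntegral.continuous_primitive (intervalIntegrable_sqrt_stepPotential a b Θ) 0

lemma hasDerivAt_travel (hΘ : Θ ∈ Ioo (0 : ℝ) 1) {x : ℝ} (hx : x ∉ interfaces Θ) :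
    HasDerivAt (travel a b Θ) (√(stepPotential a b Θ x)) x := by
  refine intervalIntegral.integral_hasDerivAt_right
    (intervalIntegrable_sqrt_stepPotential a b Θ 0 x)
    ((measurable_stepPotential a b Θ).sqrt.stronglyMeasurable.stronglyMeasurableAtFilter) ?_
  refine continuousAt_const.congr (f := fun _ => √(stepPotential a b Θ x)) ?_
  -- The ratio 1 is a dummy value; only the statement about the potential is used.
  filter_upwards [eventually_eq_of_notMem_interfaces (a := a) (b := b) hΘ 1 hx] with y hy
  rw [hy.1]

/-- The travel time through one period of the medium. -/
def cellTime (a b Θ : ℝ) : ℝ :=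
  2 * (Real.pi * Θ) * √a + (2 * Real.pi - 2 * (Real.pi * Θ)) * √b

lemma travel_of_abs_le (hΘ : Θ ∈ Ioo (0 : ℝ) 1) {x : ℝ} (hx : |x| ≤ Real.pi * Θ) :
    travel a b Θ x = x * √a := by
  have hδ : 0 < Real.pi * Θ := mul_pos Real.pi_pos hΘ.1
  have h : travel a b Θ x = ∫ s in (0 : ℝ)..x, √a := by
    refine intervalIntegral.integral_congr_ae ?_
    have hne : ∀ᵐ s : ℝ, s ≠ x := by simp [ae_iff]
    filter_upwards [hne] with s hs hmem
    rw [stepPotential_inner hΘ 0]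
    have hx' := abs_le.1 hx
    rw [abs_lt]
    rcases le_total 0 x with h0 | h0
    · rw [uIoc_of_le h0] at hmem
      have := lt_of_le_of_ne hmem.2 hs
      constructor <;> push_cast <;> linarith [hmem.1]
    · rw [uIoc_of_ge h0] at hmem
      constructor <;> push_cast <;> linarith [hmem.1, hmem.2]
  rw [h, intervalIntegral.integral_const, smul_eq_mul, sub_zero]

lemma travel_sub (x y : ℝ) :
    travel a b Θ y - travel a b Θ x = ∫ s in x..y, √(stepPotential a b Θ s) :=
  intervalIntegral.integral_interval_sub_left (intervalIntegrable_sqrt_stepPotential a b Θ _ _)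
    (intervalIntegrable_sqrt_stepPotential a b Θ _ _)

lemma integral_cell (hΘ : Θ ∈ Ioo (0 : ℝ) 1) (x : ℝ) :
    ∫ s in x..x + 2 * Real.pi, √(stepPotential a b Θ s) = cellTime a b Θ := by
  have hπ := Real.pi_pos
  have hδ : 0 < Real.pi * Θ := mul_pos hπ hΘ.1
  have hδ2 : Real.pi * Θ < Real.pi := by nlinarith [hΘ.2]
  have hper : Function.Periodic (fun s => √(stepPotential a b Θ s)) (2 * Real.pi) := fun s => by
    simp only [periodic_stepPotential a b Θ s]
  -- Started at -πΘ, the period consists of one full inner layer followed by one full outer layer.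
  rw [hper.intervalIntegral_add_eq x (-(Real.pi * Θ)),
    ← intervalIntegral.integral_add_adjacent_intervals (b := Real.pi * Θ)
    (intervalIntegrable_sqrt_stepPotential a b Θ _ _)
    (intervalIntegrable_sqrt_stepPotential a b Θ _ _), ← travel_sub,
    travel_of_abs_le hΘ (abs_of_pos hδ).le, travel_of_abs_le hΘ (by rw [abs_neg, abs_of_pos hδ])]
  have h : ∫ s in Real.pi * Θ..-(Real.pi * Θ) + 2 * Real.pi, √(stepPotential a b Θ s)
      = ∫ s in Real.pi * Θ..-(Real.pi * Θ) + 2 * Real.pi, √b := by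
    refine intervalIntegral.integral_congr fun s hs => ?_
    rw [uIcc_of_le (by linarith)] at hs
    rw [stepPotential_outer hΘ 0] <;> push_cast <;> linarith [hs.1, hs.2]
  rw [h, intervalIntegral.integral_const, smul_eq_mul, cellTime]
  ring

lemma travel_add_int (hΘ : Θ ∈ Ioo (0 : ℝ) 1) (n : ℤ) (x : ℝ) :
    travel a b Θ (2 * Real.pi * n + x) = n * cellTime a b Θ + travel a b Θ x := by
  have hper : Function.Periodic (fun s => √(stepPotential a b Θ s)) (2 * Real.pi) := fun s => by
    simp only [periodic_stepPotential a b Θ s]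
  have h := hper.intervalIntegral_add_zsmul_eq n x
    (fun t₁ t₂ => intervalIntegrable_sqrt_stepPotential a b Θ t₁ t₂)
  rw [← travel_sub, integral_cell hΘ, zsmul_eq_mul, zsmul_eq_mul, mul_comm (n : ℝ) (2 * Real.pi), add_comm x] at h
  linarith

end Potential

/-! ### The wave generated by a profile -/

/-- The combination of `f` with its translate by `τ` that travels in one direction. -/
def comb (σ τ : ℝ) (f : ℝ → ℝ) (s : ℝ) : ℝ := (f s + σ * f (s + τ)) / 2

/-- The superposition, with sign `ε`, of the two travelling waves generated by `f`, as a function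
of position and time in the medium with travel time `y`. -/
def superpose (y : ℝ → ℝ) (ε σ τ : ℝ) (f : ℝ → ℝ) (p : ℝ × ℝ) : ℝ :=
  comb σ τ f (p.2 + y p.1) + ε * comb (-σ) τ f (p.2 - y p.1)

lemma continuous_superpose {y f : ℝ → ℝ} (hy : Continuous y) (hf : Continuous f) (ε σ τ : ℝ) :
    Continuous (superpose y ε σ τ f) := by
  unfold superpose comb; fun_prop

lemma abs_comb_le {σ τ M : ℝ} {f : ℝ → ℝ} (hσ : |σ| = 1) (hf : ∀ t, |f t| ≤ M) (s : ℝ) :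
    |comb σ τ f s| ≤ M := by
  have h1 := abs_add_le (f s) (σ * f (s + τ))
  rw [abs_mul, hσ, one_mul] at h1
  rw [comb, abs_div, abs_two]
  linarith [hf s, hf (s + τ)]

lemma abs_superpose_le {y f : ℝ → ℝ} {ε σ τ M : ℝ} (hε : |ε| = 1) (hσ : |σ| = 1)
    (hf : ∀ t, |f t| ≤ M) (p : ℝ × ℝ) : |superpose y ε σ τ f p| ≤ 2 * M := by
  have h1 := abs_add_le (comb σ τ f (p.2 + y p.1)) (ε * comb (-σ) τ f (p.2 - y p.1))
  rw [abs_mul, hε, one_mul] at h1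
  rw [superpose]
  linarith [abs_comb_le (τ := τ) hσ hf (p.2 + y p.1),
    abs_comb_le (σ := -σ) (τ := τ) (by rwa [abs_neg]) hf (p.2 - y p.1)]

lemma hasDerivAt_comb {v z : ℝ → ℝ} (hv : ∀ t, HasDerivAt v (z t) t) (σ τ s : ℝ) :
    HasDerivAt (comb σ τ v) (comb σ τ z s) s :=
  ((hv s).add (((hv (s + τ)).comp_add_const s τ).const_mul σ)).div_const 2

lemma hasDerivAt_superpose_time {v z : ℝ → ℝ} (hv : ∀ t, HasDerivAt v (z t) t) (y : ℝ → ℝ)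
    (ε σ τ x t : ℝ) : HasDerivAt (fun s => superpose y ε σ τ v (x, s))
      (superpose y ε σ τ z (x, t)) t :=
  ((hasDerivAt_comb hv σ τ (t + y x)).comp_add_const t (y x)).add
    (((hasDerivAt_comb hv (-σ) τ (t - y x)).comp_sub_const t (y x)).const_mul ε)

/-- The two waves depend on t + y and t - y, so the space derivative flips the relative sign ε. This
exchange makes the superpositions with ε = 1 and ε = -1 conjugate to each other. -/
lemma hasDerivAt_superpose_space {v z : ℝ → ℝ} (hv : ∀ t, HasDerivAt v (z t) t) {y : ℝ → ℝ}
    {x y' : ℝ} (hy : HasDerivAt y y' x) (ε σ τ t : ℝ) :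
    HasDerivAt (fun s => superpose y ε σ τ v (s, t)) (y' * superpose y (-ε) σ τ z (x, t)) x := by
  have h1 := (hasDerivAt_comb hv σ τ (t + y x)).comp x (hy.const_add t)
  have h2 := ((hasDerivAt_comb hv (-σ) τ (t - y x)).comp x (hy.const_sub t)).const_mul ε
  refine (h1.add h2).congr_deriv ?_
  simp only [superpose]; ring

section Vanishing

variable {y v : ℝ → ℝ} {σ τ x : ℝ}

/-- Positions at which the two waves cancel. -/
lemma superpose_one_eq_zero (hσ : σ * σ = 1) (hanti : ∀ t, v (t + 2 * τ) = -v t)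
    (h : ∀ u, v (u + 2 * y x) = σ * v (u + τ)) (t : ℝ) : superpose y 1 σ τ v (x, t) = 0 := by
  have h1 := h (t - y x)
  have h2 := h (t - y x + τ)
  rw [show t - y x + 2 * y x = t + y x by ring] at h1
  rw [show t - y x + τ + 2 * y x = t + y x + τ by ring,
    show t - y x + τ + τ = t - y x + 2 * τ by ring, hanti] at h2
  simp only [superpose, comb, h1, h2]
  linear_combination -(v (t - y x) / 2) * hσ

/-- Positions at which the two waves are equal. -/
lemma superpose_neg_one_eq_zero (hσ : σ * σ = 1) (hanti : ∀ t, v (t + 2 * τ) = -v t)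
    (h : ∀ u, v (u + 2 * y x) = -(σ * v (u + τ))) (t : ℝ) :
    superpose y (-1) σ τ v (x, t) = 0 := by
  have h1 := h (t - y x)
  have h2 := h (t - y x + τ)
  rw [show t - y x + 2 * y x = t + y x by ring] at h1
  rw [show t - y x + τ + 2 * y x = t + y x + τ by ring,
    show t - y x + τ + τ = t - y x + 2 * τ by ring, hanti] at h2
  simp only [superpose, comb, h1, h2]
  linear_combination (v (t - y x) / 2) * hσ

end Vanishing

/-- A profile with the right symmetries and the right derivative at the origin is the trace of an
exponentially localized weak solution. -/
theorem exists_weakSolution_of_profile {a b Θ T γ τ σ r e α β M : ℝ} {v z : ℝ → ℝ}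
    (ha : 0 < a) (hb : 0 < b) (hΘ : Θ ∈ Ioo (0 : ℝ) 1) (hT : 0 < T)
    (hr : 0 < r) (hr1 : r < 1) (hα : 0 < α) (hβ : 0 < β)
    (he : e = Real.pi * Θ ∨ e = -(Real.pi * Θ))
    (hcell : ∀ x, x ∉ interfaces Θ →
      α * amp r e x * √(stepPotential a b Θ x) = β * amp r (-e) x)
    (hα0 : α * amp r e 0 = 1) (hβ0 : β * amp r (-e) 0 = √a)
    (hσ : |σ| = 1) (hz : Continuous z) (hv : ∀ t, HasDerivAt v (z t) t)
    (hvM : ∀ t, |v t| ≤ M) (hzM : ∀ t, |z t| ≤ M)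
    (hanti : ∀ t, v (t + 2 * τ) = -v t) (hvT : Function.Periodic v T)
    (hvcell : Function.Periodic v (2 * cellTime a b Θ))
    (hshift : ∀ u, v (u - 2 * (e * √a)) = σ * v (u + τ))
    (hjump : ∀ t, γ * z t ^ 3 = 2 * √a * σ * v (t + τ)) :
    ∃ w : ℝ × ℝ → ℝ, Continuous w ∧ IsWeakSolution (stepPotential a b Θ) γ T w ∧
      (∀ t, w (0, t) = v t) ∧
      ∃ C ρ : ℝ, 0 < C ∧ 0 < ρ ∧ ∀ x t : ℝ, |w (x, t)| ≤ C * Real.exp (-ρ * |x|) := by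
  have hπ := Real.pi_pos
  have hδ : 0 < Real.pi * Θ := mul_pos hπ hΘ.1
  have hδπ : Real.pi * Θ < Real.pi := by nlinarith [hΘ.2]
  have heabs : |e| = Real.pi * Θ := by
    rcases he with rfl | rfl
    · exact abs_of_pos hδ
    · rw [abs_neg, abs_of_pos hδ]
  have hσ2 : σ * σ = 1 := by rw [← abs_mul_abs_self, hσ, one_mul]
  have hvc : Continuous v := continuous_iff_continuousAt.2 fun t => (hv t).continuousAt
  set g := stepPotential a b Θ
  set y := travel a b Θ
  have hyc : Continuous y := continuous_travel a b Θ
  have hy0 : y 0 = 0 := by simp [y, travel]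
  have hM : 0 ≤ M := (abs_nonneg _).trans (hvM 0)
  have hlocal : ∀ x, x ∉ interfaces Θ →
      ∀ᶠ s in 𝓝 x, amp r e s = amp r e x ∧ amp r (-e) s = amp r (-e) x := by
    intro x hx
    filter_upwards [eventually_eq_of_notMem_interfaces (a := a) (b := b) hΘ r hx] with s hs
    rcases he with rfl | rfl
    · exact hs.2
    · rw [neg_neg]; exact hs.2.symm
  -- Reversing the shift changes the sign, by antiperiodicity. Hence the same e yields zeros of P at
  -- 2πn - e and zeros of Q at 2πn + e.
  have hshift' : ∀ u, v (u + 2 * (e * √a)) = -(σ * v (u + τ)) := by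
    intro u
    have h1 := hshift (u + 2 * (e * √a) + τ)
    rw [show u + 2 * (e * √a) + τ - 2 * (e * √a) = u + τ by ring,
      show u + 2 * (e * √a) + τ + τ = u + 2 * (e * √a) + 2 * τ by ring, hanti] at h1
    rw [h1]
    linear_combination -(v (u + 2 * (e * √a))) * hσ2
  have hP0 : ∀ (n : ℤ) t, superpose y 1 σ τ v (2 * Real.pi * n - e, t) = 0 := by
    intro n t
    refine superpose_one_eq_zero hσ2 hanti (fun u => ?_) t
    have h1 : y (2 * Real.pi * n - e) = n * cellTime a b Θ - e * √a := by
      change travel a b Θ _ = _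
      rw [sub_eq_add_neg, travel_add_int hΘ, travel_of_abs_le hΘ (by rw [abs_neg, heabs])]
      ring
    -- Twice the travel time through a cell is a period of v, so the condition at 2πn - e reduces to
    -- the one at -e.
    rw [h1, ← hshift u, show u + 2 * (n * cellTime a b Θ - e * √a)
      = u - 2 * (e * √a) + n * (2 * cellTime a b Θ) by ring]
    exact hvcell.int_mul n _
  have hQ0 : ∀ (n : ℤ) t, superpose y (-1) σ τ v (2 * Real.pi * n - -e, t) = 0 := by
    intro n t
    refine superpose_neg_one_eq_zero hσ2 hanti (fun u => ?_) t
    have h1 : y (2 * Real.pi * n - -e) = n * cellTime a b Θ + e * √a := by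
      change travel a b Θ _ = _
      rw [sub_neg_eq_add, travel_add_int hΘ, travel_of_abs_le hΘ heabs.le]
    rw [h1, ← hshift' u, show u + 2 * (n * cellTime a b Θ + e * √a)
      = u + 2 * (e * √a) + n * (2 * cellTime a b Θ) by ring]
    exact hvcell.int_mul n _
  have hPc : Continuous fun p : ℝ × ℝ => α * (amp r e p.1 * superpose y 1 σ τ v p) :=
    (continuous_amp_mul hr hr1 (continuous_superpose hyc hvc _ _ _) hP0).const_mul α
  have hQc : Continuous fun p : ℝ × ℝ => β * (amp r (-e) p.1 * superpose y (-1) σ τ v p) :=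
    (continuous_amp_mul hr hr1 (continuous_superpose hyc hvc _ _ _) hQ0).const_mul β
  have hsT : ∀ ε, TimePeriodic T (superpose y ε σ τ v) := by
    intro ε x t
    simp only [superpose, comb]
    rw [show t + T + y x + τ = t + y x + τ + T by ring, show t + T + y x = t + y x + T by ring,
      show t + T - y x + τ = t - y x + τ + T by ring, show t + T - y x = t - y x + T by ring,
      hvT, hvT, hvT, hvT]
  set ρ := -Real.log r / (2 * Real.pi)
  have hρ : 0 < ρ := div_pos (neg_pos.2 (Real.log_neg hr hr1)) Real.two_pi_pos
  set C := (α + β) * r ^ (-2 : ℤ) * (2 * M)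
  have hbound : ∀ (k e' ε : ℝ) (f : ℝ → ℝ), 0 < k → k ≤ α + β → |e'| < Real.pi → |ε| = 1 →
      (∀ t, |f t| ≤ M) → ∀ x t, |k * (amp r e' x * superpose y ε σ τ f (x, t))|
        ≤ C * Real.exp (-ρ * x) := by
    intro k e' ε f hk hk' he' hε hf x t
    rw [abs_mul, abs_mul, abs_of_pos hk, abs_of_pos (amp_pos hr _ _)]
    calc k * (amp r e' x * |superpose y ε σ τ f (x, t)|)
        ≤ (α + β) * ((r ^ (-2 : ℤ) * Real.exp (-ρ * x)) * (2 * M)) := by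
          gcongr
          · exact mul_nonneg (amp_pos hr _ _).le (abs_nonneg _)
          · exact amp_le hr hr1 he' x
          · exact abs_superpose_le hε hσ hf _
      _ = C * Real.exp (-ρ * x) := by ring
  have hk1 : α ≤ α + β := by linarith
  have hk2 : β ≤ α + β := by linarith
  have he1 : |e| < Real.pi := heabs ▸ hδπ
  have he2 : |-e| < Real.pi := by rwa [abs_neg]
  have pair : ConjugatePair g T C ρ (interfaces Θ)
      (fun p => α * (amp r e p.1 * superpose y 1 σ τ v p))
      (fun p => β * (amp r (-e) p.1 * superpose y (-1) σ τ v p))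
      (fun p => α * (amp r e p.1 * superpose y 1 σ τ z p))
      (fun p => β * (amp r (-e) p.1 * superpose y (-1) σ τ z p)) :=
    { countable := countable_interfaces Θ
      rate_pos := hρ
      continuous_fst := hPc
      continuous_snd := hQc
      measurable_fst := (((measurable_amp r e).comp measurable_fst).mul
        (continuous_superpose hyc hz _ _ _).measurable).const_mul α
      measurable_snd := (((measurable_amp r (-e)).comp measurable_fst).mul
        (continuous_superpose hyc hz _ _ _).measurable).const_mul β
      periodic_fst := fun x t => by simp only [hsT 1 x t]
      periodic_snd := fun x t => by simp only [hsT (-1) x t]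
      hasDerivAt_time_fst := fun x t =>
        ((hasDerivAt_superpose_time hv y 1 σ τ x t).const_mul (amp r e x)).const_mul α
      hasDerivAt_time_snd := fun x t =>
        ((hasDerivAt_superpose_time hv y (-1) σ τ x t).const_mul (amp r (-e) x)).const_mul β
      continuous_time_fst := fun x => by
        have := (continuous_superpose hyc hz 1 σ τ).comp (Continuous.prodMk_right x)
        exact (this.const_mul (amp r e x)).const_mul α
      continuous_time_snd := fun x => by
        have := (continuous_superpose hyc hz (-1) σ τ).comp (Continuous.prodMk_right x)
        exact (this.const_mul (amp r (-e) x)).const_mul β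
      hasDerivAt_space_fst := fun t x _ hx => by
        have h1 := (((hasDerivAt_superpose_space hv (hasDerivAt_travel (a := a) (b := b) hΘ hx)
          1 σ τ t).const_mul (amp r e x)).const_mul α)
        refine (h1.congr_of_eventuallyEq ?_).congr_deriv ?_
        · filter_upwards [hlocal x hx] with s hs
          rw [hs.1]
        -- `hcell` matches the amplitudes: differentiating P produces the factor √g, and α `amp` √g
        -- is the amplitude of Q.
        · linear_combination (superpose y (-1) σ τ z (x, t)) * hcell x hx
      hasDerivAt_space_snd := fun t x _ hx => by
        have h1 := (((hasDerivAt_superpose_space hv (hasDerivAt_travel (a := a) (b := b) hΘ hx)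
          (-1) σ τ t).const_mul (amp r (-e) x)).const_mul β)
        rw [neg_neg] at h1
        have hg : √(g x) * √(g x) = g x := by
          refine Real.mul_self_sqrt ?_
          rcases stepPotential_eq_or a b Θ x with h | h
          · exact ha.le.trans_eq h.symm
          · exact hb.le.trans_eq h.symm
        refine (h1.congr_of_eventuallyEq ?_).congr_deriv ?_
        · filter_upwards [hlocal x hx] with s hs
          rw [hs.2]
        · linear_combination -(√(g x) * superpose y 1 σ τ z (x, t)) * hcell x hx
            + α * amp r e x * superpose y 1 σ τ z (x, t) * hg
      bound_P := fun x t _ => hbound α e 1 v hα hk1 he1 abs_one hvM x t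
      bound_Q := fun x t _ => hbound β (-e) (-1) v hβ hk2 he2 (by simp) hvM x t
      bound_p := fun x t _ => hbound α e 1 z hα hk1 he1 abs_one hzM x t
      bound_q := fun x t _ => hbound β (-e) (-1) z hβ hk2 he2 (by simp) hzM x t }
  have hP00 : ∀ f t, α * (amp r e 0 * superpose y 1 σ τ f (0, t)) = f t := by
    intro f t
    rw [← mul_assoc, hα0]; simp only [superpose, comb, hy0, add_zero, sub_zero]; ring
  have hQ00 : ∀ t, β * (amp r (-e) 0 * superpose y (-1) σ τ v (0, t)) = √a * (σ * v (t + τ)) := by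
    intro t
    rw [← mul_assoc, hβ0]; simp only [superpose, comb, hy0, add_zero, sub_zero]; ring
  refine ⟨_, continuous_evenReflection hPc, pair.isWeakSolution hT (G := a + b)
    (measurable_stepPotential a b Θ) (fun x => ?_) (stepPotential_abs hΘ) (fun t => ?_),
    fun t => ?_, C + 1, ρ, ?_, hρ, fun x t => ?_⟩
  · rcases stepPotential_eq_or a b Θ x with h | h <;> simp only [g, h]
    · rw [abs_of_pos ha]; linarith
    · rw [abs_of_pos hb]; linarith
  · simp only [hP00, hQ00]
    rw [hjump]; ring
  · simp only [evenReflection, abs_zero, hP00]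
  · positivity
  · refine (abs_evenReflection_le pair.bound_P x t).trans ?_
    gcongr
    linarith

end KerrBreather

end

noncomputable section

namespace KerrBreather

open MeasureTheory Filter Topology Set

/-! ### Choice of the quarter periods -/

section Antiperiodic

variable {v : ℝ → ℝ} {τ : ℝ}

lemma add_odd_mul_of_antiperiodic (h : ∀ t, v (t + 2 * τ) = -v t) (i : ℕ) (t : ℝ) :
    v (t + (2 * i + 1) * τ) = (-1) ^ i * v (t + τ) := by
  induction i with
  | zero => simp
  | succ k ih =>
    rw [show t + (2 * ((k + 1 : ℕ) : ℝ) + 1) * τ = t + (2 * k + 1) * τ + 2 * τ by push_cast; ring,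
      h, ih]
    ring

lemma sub_odd_mul_of_antiperiodic (h : ∀ t, v (t + 2 * τ) = -v t) (i : ℕ) (t : ℝ) :
    v (t - (2 * i + 1) * τ) = -((-1) ^ i * v (t + τ)) := by
  have h1 := add_odd_mul_of_antiperiodic h i (t - (2 * i + 1) * τ + τ)
  rw [show t - (2 * (i : ℝ) + 1) * τ + τ + (2 * i + 1) * τ = t + τ by ring,
    show t - (2 * (i : ℝ) + 1) * τ + τ + τ = t - (2 * i + 1) * τ + 2 * τ by ring, h] at h1
  rw [h1, mul_neg, mul_neg, neg_neg, ← mul_assoc, ← mul_pow]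
  simp

lemma periodic_four_mul_of_antiperiodic (h : ∀ t, v (t + 2 * τ) = -v t) (k : ℕ) :
    Function.Periodic v (4 * k * τ) := by
  have h4 : Function.Periodic v (4 * τ) := fun t => by
    rw [show t + 4 * τ = t + 2 * τ + 2 * τ by ring, h, h, neg_neg]
  have := h4.nat_mul k
  rwa [show (k : ℝ) * (4 * τ) = 4 * k * τ by ring] at this

end Antiperiodic

/-- The travel times through the two layers are odd multiples of arbitrarily small `τ` with `4 τ`
dividing the period; moreover the residue modulo `4` of the first of them can be prescribed. -/
lemma exists_quarterPeriods {a b Θ ω : ℝ} (ha : 0 < a) (hΘ : Θ ∈ Ioo (0 : ℝ) 1)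
    (hl : IsOddRatio (√(b / a) * ((1 - Θ) / Θ))) (hω : IsOddRatio (4 * √a * Θ * ω))
    {ε : ℝ} (hε : ε = 1 ∨ ε = -1) : 0 < 2 * Real.pi / ω ∧ ∃ τ : ℕ → ℝ, StrictAnti τ ∧
      ∀ n, 0 < τ n ∧ ∃ i j k : ℕ, (-1) ^ i = ε ∧ 2 * (Real.pi * Θ) * √a = (2 * i + 1) * τ n ∧
        (2 * Real.pi - 2 * (Real.pi * Θ)) * √b = (2 * j + 1) * τ n ∧
        2 * Real.pi / ω = 4 * k * τ n := by
  have hπ := Real.pi_pos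
  have hΘ0 := hΘ.1
  obtain ⟨m₁, n₁, h1⟩ := hl
  obtain ⟨m₂, n₂, h2⟩ := hω
  have hsa : 0 < √a := Real.sqrt_pos.2 ha
  have hω0 : 0 < ω := by
    have : 0 < 4 * √a * Θ * ω := by rw [h2]; positivity
    exact (pos_iff_pos_of_mul_pos this).1 (by positivity)
  have hT : 0 < 2 * Real.pi / ω := by positivity
  -- In terms of the τ chosen below, the inner layer is crossed in (2f + 1)(2(2n + s) + 1) steps.
  -- This number is 2i + 1 with i ≡ f + s modulo 2, so s is chosen to correct the sign.
  obtain ⟨f, hf⟩ : ∃ f : ℕ, (2 * n₁ + 1) * (2 * m₂ + 1) = 2 * f + 1 :=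
    ⟨2 * n₁ * m₂ + n₁ + m₂, by ring⟩
  have hf' : (2 * (n₁ : ℝ) + 1) * (2 * m₂ + 1) = 2 * f + 1 := by exact_mod_cast hf
  obtain ⟨s, hs⟩ : ∃ s : ℕ, (-1 : ℝ) ^ (f + s) = ε := by
    rcases neg_one_pow_eq_or ℝ f with h | h <;> rcases hε with rfl | rfl
    · exact ⟨0, by simpa using h⟩
    · exact ⟨1, by rw [pow_succ, h]; norm_num⟩
    · exact ⟨1, by rw [pow_succ, h]; norm_num⟩
    · exact ⟨0, by simpa using h⟩
  -- The factors 2n₁ + 1 and 2n₂ + 1 clear the denominators of the two odd ratios. Any further odd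
  -- factor is harmless; going through 2(2n + s) + 1 keeps the parity of i fixed.
  refine ⟨hT, fun n => 2 * Real.pi / ω /
    (4 * ((2 * n₁ + 1) * (2 * n₂ + 1) * (2 * (2 * n + s) + 1))), ?_, fun n => ⟨by positivity, ?_⟩⟩
  · intro x y hxy
    have : (x : ℝ) < y := by exact_mod_cast hxy
    simp only
    gcongr
  have e1 : 2 * (Real.pi * Θ) * √a =
      2 * Real.pi / ω / 4 * ((2 * m₂ + 1) / (2 * n₂ + 1)) := by
    rw [← h2]; field_simp
  have e2 : (2 * Real.pi - 2 * (Real.pi * Θ)) * √b =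
      2 * (Real.pi * Θ) * √a * ((2 * m₁ + 1) / (2 * n₁ + 1)) := by
    rw [← h1, Real.sqrt_div' _ ha.le]; field_simp
  refine ⟨f + s + 2 * (f * (2 * n + s) + n), m₁ + m₂ + 2 * m₁ * m₂ +
    (2 * m₁ + 1) * (2 * m₂ + 1) * (2 * n + s),
    (2 * n₁ + 1) * (2 * n₂ + 1) * (2 * (2 * n + s) + 1), ?_, ?_, ?_, ?_⟩
  · rw [pow_add, pow_mul, hs]; simp
  · rw [e1, show (2 * ((f + s + 2 * (f * (2 * n + s) + n) : ℕ) : ℝ) + 1) =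
      (2 * n₁ + 1) * (2 * m₂ + 1) * (2 * (2 * n + s) + 1) by rw [hf']; push_cast; ring]
    field_simp
  · rw [e2, e1]
    push_cast
    field_simp
    ring
  · push_cast
    field_simp

/-- The two amplitudes of a layered medium, according to which of the layers is denser. -/
lemma exists_amplitudes {a b Θ : ℝ} (ha : 0 < a) (hb : 0 < b) (hab : a ≠ b)
    (hΘ : Θ ∈ Ioo (0 : ℝ) 1) : ∃ r ς α β : ℝ, 0 < r ∧ r < 1 ∧ 0 < α ∧ 0 < β ∧
      (ς = 1 ∨ ς = -1) ∧
      (∀ x, x ∉ interfaces Θ → α * amp r (ς * (Real.pi * Θ)) x * √(stepPotential a b Θ x)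
        = β * amp r (-(ς * (Real.pi * Θ))) x) ∧
      α * amp r (ς * (Real.pi * Θ)) 0 = 1 ∧ β * amp r (-(ς * (Real.pi * Θ))) 0 = √a := by
  have hsa : 0 < √a := Real.sqrt_pos.2 ha
  have hsb : 0 < √b := Real.sqrt_pos.2 hb
  have hδ : 0 < Real.pi * Θ := mul_pos Real.pi_pos hΘ.1
  have h0 : |(0 : ℝ) - 2 * Real.pi * (0 : ℤ)| < Real.pi * Θ := by simpa using hδ
  rcases lt_or_gt_of_ne hab with hlt | hlt
  · have hr : 0 < √a / √b := by positivity
    have hr1 : √a / √b < 1 := (div_lt_one hsb).2 (Real.sqrt_lt_sqrt ha.le hlt)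
    obtain ⟨-, e1, e2⟩ := layer_inner (a := a) (b := b) hΘ (√a / √b) h0
    -- For a < b, √g increases on leaving an inner layer, so the amplitude of P must drop at 2πn +
    -- πΘ. With this shift `amp` equals r⁻¹ at 0, which forces α = r.
    refine ⟨√a / √b, -1, √a / √b, √a, hr, hr1, hr, hsa, Or.inr rfl, fun x hx => ?_, ?_, ?_⟩
    · rw [neg_one_mul, neg_neg]
      obtain ⟨n, h | ⟨h1, h2⟩⟩ := mem_layer_of_notMem_interfaces hx
      · obtain ⟨f1, f2, f3⟩ := layer_inner (a := a) (b := b) hΘ (√a / √b) h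
        rw [f1, f2, f3, zpow_sub_one₀ hr.ne']; field_simp
      · obtain ⟨f1, f2, f3⟩ := layer_outer (a := a) (b := b) hΘ (√a / √b) h1 h2
        rw [f1, f2, f3]; field_simp
    · rw [neg_one_mul, e2, zero_sub, zpow_neg_one, mul_inv_cancel₀ hr.ne']
    · rw [neg_one_mul, neg_neg, e1, zpow_zero, mul_one]
  · have hr : 0 < √b / √a := by positivity
    have hr1 : √b / √a < 1 := (div_lt_one hsa).2 (Real.sqrt_lt_sqrt hb.le hlt)
    obtain ⟨-, e1, e2⟩ := layer_inner (a := a) (b := b) hΘ (√b / √a) h0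
    -- For a > b the roles are exchanged: P drops on entering an inner layer, and now the amplitude
    -- of Q is the one with r⁻¹ at 0.
    refine ⟨√b / √a, 1, 1, √b, hr, hr1, one_pos, hsb, Or.inl rfl, fun x hx => ?_, ?_, ?_⟩
    · simp only [one_mul]
      obtain ⟨n, h | ⟨h1, h2⟩⟩ := mem_layer_of_notMem_interfaces hx
      · obtain ⟨f1, f2, f3⟩ := layer_inner (a := a) (b := b) hΘ (√b / √a) h
        rw [f1, f2, f3, zpow_sub_one₀ hr.ne']; field_simp
      · obtain ⟨f1, f2, f3⟩ := layer_outer (a := a) (b := b) hΘ (√b / √a) h1 h2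
        rw [f1, f2, f3]; field_simp
    · simp only [one_mul]; rw [e1, zpow_zero]
    · rw [one_mul, e2, zero_sub, zpow_neg_one]; field_simp

lemma abs_le_one_add_of_pow_three_eq {x y M : ℝ} (h : x ^ 3 = y) (hy : |y| ≤ M) :
    |x| ≤ 1 + M := by
  have h1 : |x| ^ 3 ≤ M := by rw [← abs_pow, h]; exact hy
  have hM : 0 ≤ M := (abs_nonneg _).trans hy
  rcases le_total |x| 1 with h2 | h2
  · linarith
  · linarith [le_self_pow₀ h2 (by norm_num : (3 : ℕ) ≠ 0)]

/-- Exponentially localized weak solutions whose traces at the origin have pairwise different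
maxima. -/
theorem exists_weakSolutions {a b Θ ω γ : ℝ} (ha : 0 < a) (hb : 0 < b) (hab : a ≠ b)
    (hΘ : Θ ∈ Ioo (0 : ℝ) 1) (hl : IsOddRatio (√(b / a) * ((1 - Θ) / Θ)))
    (hω : IsOddRatio (4 * √a * Θ * ω)) (hγ : γ ≠ 0) :
    ∃ (w : ℕ → ℝ × ℝ → ℝ) (A : ℕ → ℝ), Function.Injective A ∧ ∀ n, 0 < A n ∧ Continuous (w n) ∧
      IsWeakSolution (stepPotential a b Θ) γ (2 * Real.pi / ω) (w n) ∧
      (∀ t, |w n (0, t)| ≤ A n) ∧ (∃ t, w n (0, t) = A n) ∧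
      ∃ C ρ : ℝ, 0 < C ∧ 0 < ρ ∧ ∀ x t : ℝ, |w n (x, t)| ≤ C * Real.exp (-ρ * |x|) := by
  have hsa : 0 < √a := Real.sqrt_pos.2 ha
  obtain ⟨r, ς, α, β, hr, hr1, hα, hβ, hς, hcell, hα0, hβ0⟩ := exists_amplitudes ha hb hab hΘ
  obtain ⟨σ, hσ, hσγ⟩ : ∃ σ : ℝ, (σ = 1 ∨ σ = -1) ∧ γ = σ * |γ| := by
    rcases le_total 0 γ with h | h
    · exact ⟨1, Or.inl rfl, by rw [abs_of_nonneg h, one_mul]⟩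
    · exact ⟨-1, Or.inr rfl, by rw [abs_of_nonpos h]; ring⟩
  -- The parity sign (-1)^i required by the shift condition: ς records which of a, b is larger, σ is
  -- the sign of γ.
  have hε : -(ς * σ) = 1 ∨ -(ς * σ) = -1 := by
    rcases hς with rfl | rfl <;> rcases hσ with rfl | rfl <;> simp
  have hγ0 : 0 < |γ| := abs_pos.2 hγ
  obtain ⟨hT, τ, hτ, hτn⟩ := exists_quarterPeriods ha hΘ hl hω hε
  have hκ : 0 < 2 * √a / |γ| := by positivity
  obtain ⟨A, hA, hprof⟩ := exists_scaled_profile hκ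
  have key : ∀ n, ∃ w : ℝ × ℝ → ℝ, 0 < A (τ n) ∧ Continuous w ∧
      IsWeakSolution (stepPotential a b Θ) γ (2 * Real.pi / ω) w ∧
      (∀ t, |w (0, t)| ≤ A (τ n)) ∧ (∃ t, w (0, t) = A (τ n)) ∧
      ∃ C ρ : ℝ, 0 < C ∧ 0 < ρ ∧ ∀ x t : ℝ, |w (x, t)| ≤ C * Real.exp (-ρ * |x|) := by
    intro n
    obtain ⟨hτ0, i, j, k, hi, hTa, hTb, hTk⟩ := hτn n
    obtain ⟨v, z, hz, hv, hvz, hanti, hbd, hmax, hApos⟩ := hprof (τ n) hτ0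
    have hM : ∀ t, |2 * √a / |γ| * v (t + τ n)| ≤ 2 * √a / |γ| * A (τ n) := fun t => by
      rw [abs_mul, abs_of_pos hκ]; gcongr; exact hbd _
    obtain ⟨w, hwc, hw, hw0, hwexp⟩ := exists_weakSolution_of_profile (γ := γ) (τ := τ n) (σ := σ)
      -- One constant for both v and z: the first summand bounds v, the second bounds z through |z|
      -- ≤ 1 + |z³|.
      (e := ς * (Real.pi * Θ)) (M := A (τ n) + (1 + 2 * √a / |γ| * A (τ n))) ha hb hΘ hT hr hr1 hα hβ
      (by rcases hς with rfl | rfl <;> simp) hcell hα0 hβ0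
      (by rcases hσ with rfl | rfl <;> simp) hz hv
      (fun t => (hbd t).trans (le_add_of_nonneg_right (by positivity)))
      (fun t => (abs_le_one_add_of_pow_three_eq (hvz t) (hM t)).trans
        (le_add_of_nonneg_left hApos.le)) hanti
      (hTk ▸ periodic_four_mul_of_antiperiodic hanti k)
      (by
        -- Two odd multiples of τ add up to 2(i + j + 1)τ, so twice the cell time is a multiple of
        -- the period 4τ.
        have h := periodic_four_mul_of_antiperiodic hanti (i + j + 1)
        rw [cellTime, hTa, hTb]
        convert h using 1
        push_cast; ring)
      (fun u => by
        rcases hς with rfl | rfl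
        · rw [one_mul, ← mul_assoc, hTa, sub_odd_mul_of_antiperiodic hanti, hi]; ring
        · rw [show u - 2 * (-1 * (Real.pi * Θ) * √a) = u + 2 * (Real.pi * Θ) * √a by ring, hTa,
            add_odd_mul_of_antiperiodic hanti, hi]
          ring)
      (fun t => by
        rw [hvz]
        nth_rewrite 1 [hσγ]
        field_simp)
    exact ⟨w, hApos, hwc, hw, fun t => by rw [hw0]; exact hbd t, ⟨τ n, by rw [hw0, hmax]⟩, hwexp⟩
  choose w hw using key
  refine ⟨w, fun n => A (τ n), fun m n h => hτ.injective ?_, hw⟩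
  exact hA.injOn (hτn m).1 (hτn n).1 h

end KerrBreather

end

/-! ### Nontriviality and distinctness up to time translation -/

theorem mainTheorem4 (a b Θ ω γ : ℝ) (ha : 0 < a) (hb : 0 < b) (hab : a ≠ b)
    (hΘ : Θ ∈ Set.Ioo (0 : ℝ) 1)
    (hl : KerrBreather.IsOddRatio (Real.sqrt (b / a) * ((1 - Θ) / Θ)))
    (hω : KerrBreather.IsOddRatio (4 * Real.sqrt a * Θ * ω))
    (hγ : γ ≠ 0) :
    ∃ w : ℕ → ℝ × ℝ → ℝ,
      (∀ n,
        KerrBreather.IsWeakSolution (KerrBreather.stepPotential a b Θ) γ (2 * Real.pi / ω) (w n) ∧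
        ¬ (w n =ᵐ[MeasureTheory.volume] 0) ∧
        ∃ C ρ : ℝ, 0 < C ∧ 0 < ρ ∧
          ∀ x t : ℝ, |w n (x, t)| ≤ C * Real.exp (-ρ * |x|)) ∧
      (∀ m n, m ≠ n → ∀ s : ℝ,
        ¬ (w m =ᵐ[MeasureTheory.volume] fun p => w n (p.1, p.2 + s))) := by
  obtain ⟨w, A, hA, hw⟩ := KerrBreather.exists_weakSolutions ha hb hab hΘ hl hω hγ
  -- The maximum of the trace at 0 is invariant under time translation. Applied with s and -s, this
  -- forces equal maxima.
  have hle : ∀ m n s, (∀ t, w m (0, t) = w n (0, t + s)) → A m ≤ A n := by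
    intro m n s h
    obtain ⟨-, -, -, -, ⟨t, ht⟩, -⟩ := hw m
    rw [← ht, h]
    exact (le_abs_self _).trans ((hw n).2.2.2.1 _)
  refine ⟨w, fun n => ?_, fun m n hmn s h => hmn (hA ?_)⟩
  · obtain ⟨hpos, hc, hsol, -, ⟨t, ht⟩, hexp⟩ := hw n
    refine ⟨hsol, fun h => ?_, hexp⟩
    have h0 := (hc.ae_eq_iff_eq MeasureTheory.volume continuous_zero).1 h
    rw [h0] at ht
    exact hpos.ne ht
  · have hc : Continuous fun p : ℝ × ℝ => w n (p.1, p.2 + s) := by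
      have := (hw n).2.1
      fun_prop
    -- Continuity upgrades almost everywhere equality to equality everywhere, in particular on the
    -- null line x = 0.
    have h0 := ((hw m).2.1.ae_eq_iff_eq MeasureTheory.volume hc).1 h
    have h1 : ∀ t, w m (0, t) = w n (0, t + s) := fun t => congrFun h0 (0, t)
    refine le_antisymm (hle m n s h1) (hle n m (-s) fun t => ?_)
    rw [h1, neg_add_cancel_right]
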